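/- Let $p\ge 0$, let $x_1,\dots,x_p\in\mathbb R^2$ and let $f_1,\dots,f_p\in\mathbb R^2$ be a balanced system of forces supported at these points, i.e. $\sum_i f_i=0$ and $\sum_i x_i\wedge f_i=0$, where $u\wedge v=\det[u,v]$. Then for every $\varepsilon>0$ and every finite set $F\subset\mathbb R^2$ there are a planar, purely elastic network with terminals $x_1,\dots,x_p$, and a constant $c>0$, such that the static response matrix of the network is $$W=c\,ff^{T},\qquad f=(f_1^T,\dots,f_p^T)^T\in\mathbb R^{2p},$$ and such that every internal node of the network lies in $\{x\in\mathbb R^2:\operatorname{dist}(x,C)\le\varepsilon\}$, where $C$ is the convex hull of $\{x_1,\dots,x_p\}$, and does not belong to $F$. Here a purely elastic network consists of its terminals and finitely many internal nodes, all without mass, located at points of $\mathbb R^2$, and of straight springs with constants $k_{ij}>0$ that link certain pairs of nodes located at different points. If $z_i$ is the position and $u_i\in\mathbb R^2$ the displacement of node $i$, the network has the quadratic form $$q(u)=\sum_{\text{springs }\{i,j\}}k_{ij}\Big((u_i-u_j)\cdot\frac{z_i-z_j}{\|z_i-z_j\|}\Big)^2,$$ and its static response matrix is the symmetric matrix $W\in\mathbb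 R^{2p\times 2p}$ with $u_B^TWu_B=\inf_{u_I}q(u_B,u_I)$ for all displacements $u_B\in\mathbb R^{2p}$ of the terminals, the infimum being over the displacements $u_I$ of the internal nodes. The network is planar if its internal nodes are distinct from each other and from the terminals and its springs do not cross: no node lies in the relative interior of a spring, and the relative interiors of different springs are disjoint. The terminals are not required to be distinct points; distinct terminals at the same point are different nodes. -/

import Mathlib

open scoped BigOperators

/-- The Euclidean plane. -/
abbrev Plane : Type := EuclideanSpace ℝ (Fin 2)

/-- The planar cross product `u ∧ v = det [u, v]`. -/
def wedge (u v : Plane) : ℝ := u 0 * v 1 - u 1 * v 0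

/-- The forces `f i`, supported at the points `x i`, form a balanced system of forces. -/
structure IsBalanced {p : ℕ} (x f : Fin p → Plane) : Prop where
  force : ∑ i, f i = 0
  torque : ∑ i, wedge (x i) (f i) = 0

/-- The vector of `ℝ^{2p}` obtained by stacking `p` vectors of the plane. -/
def stack {p : ℕ} (f : Fin p → Plane) : Fin p × Fin 2 → ℝ := fun a => f a.1 a.2

/-- A finite, purely elastic (massless) network of springs in the plane with terminals `x`.
The nodes are the terminals and the internal nodes; `stiffness i j` is the spring constant of
the spring between the nodes `i` and `j`, and it is `0` when they are not linked by a spring. -/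
structure ElasticNetwork {p : ℕ} (x : Fin p → Plane) where
  /-- The number of internal nodes. -/
  numInternal : ℕ
  /-- The positions of the internal nodes. -/
  internal : Fin numInternal → Plane
  /-- The spring constants. -/
  stiffness : Fin p ⊕ Fin numInternal → Fin p ⊕ Fin numInternal → ℝ
  stiffness_symm : ∀ i j, stiffness i j = stiffness j i
  stiffness_nonneg : ∀ i j, 0 ≤ stiffness i j
  /-- Every spring has positive length. -/
  ne_of_stiffness_pos : ∀ i j, 0 < stiffness i j → Sum.elim x internal i ≠ Sum.elim x internal j

namespace ElasticNetwork

/-- The nodes: terminals and internal nodes. -/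
abbrev Node {p : ℕ} {x : Fin p → Plane} (N : ElasticNetwork x) : Type :=
  Fin p ⊕ Fin N.numInternal

/-- The position of a node. -/
def pos {p : ℕ} {x : Fin p → Plane} (N : ElasticNetwork x) : N.Node → Plane :=
  Sum.elim x N.internal

/-- The nodes `i` and `j` are linked by a spring. -/
def Spring {p : ℕ} {x : Fin p → Plane} (N : ElasticNetwork x) (i j : N.Node) : Prop :=
  0 < N.stiffness i j

/-- The quadratic form (twice the elastic energy) of the network in which all nodes have
prescribed displacements `u`: the sum over the springs, that is, over the unordered pairs of
nodes, of `k_{ij} ((u_i - u_j) ⬝ (x_i - x_j) / ‖x_i - x_j‖)^2`. Every spring occurs twice in the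
sum over ordered pairs, whence the factor `1 / 2`. -/
noncomputable def quadForm {p : ℕ} {x : Fin p → Plane} (N : ElasticNetwork x)
    (u : N.Node → Plane) : ℝ :=
  (1 / 2) * ∑ i, ∑ j, N.stiffness i j *
    (inner ℝ (u i - u j) (N.pos i - N.pos j) / ‖N.pos i - N.pos j‖) ^ 2

/-- The quadratic form of the response at the terminals: the infimum of the quadratic form of the
network over the displacements `v` of the internal nodes. It is the infimum of a non-empty set of
non-negative numbers. -/
noncomputable def responseForm {p : ℕ} {x : Fin p → Plane} (N : ElasticNetwork x)
    (u : Fin p → Plane) : ℝ :=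
  ⨅ v : Fin N.numInternal → Plane, N.quadForm (Sum.elim u v)

/-- `W` is the static response matrix of the network: the symmetric matrix whose quadratic form
is the response form at the terminals. -/
def IsResponseMatrix {p : ℕ} {x : Fin p → Plane} (N : ElasticNetwork x)
    (W : Matrix (Fin p × Fin 2) (Fin p × Fin 2) ℝ) : Prop :=
  W.IsSymm ∧ ∀ u : Fin p → Plane,
    dotProduct (stack u) (W.mulVec (stack u)) = N.responseForm u

/-- The network is planar. The internal nodes are pairwise distinct points, different from the
terminals, and the springs do not cross: no node lies in the relative interior of a spring and
the relative interiors of two different springs are disjoint. Thus two different springs meet at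
most in a common end point. -/
structure IsPlanar {p : ℕ} {x : Fin p → Plane} (N : ElasticNetwork x) : Prop where
  internal_injective : Function.Injective N.internal
  internal_ne_terminal : ∀ j i, N.internal j ≠ x i
  node_notMem : ∀ i j l, N.Spring i j → N.pos l ∉ openSegment ℝ (N.pos i) (N.pos j)
  no_crossing : ∀ i j i' j', N.Spring i j → N.Spring i' j' → s(i, j) ≠ s(i', j') →
    Disjoint (openSegment ℝ (N.pos i) (N.pos j)) (openSegment ℝ (N.pos i') (N.pos j'))

end ElasticNetwork

/-! Give a spring of length ℓ the constant ℓ². The quadratic form is then the sum of the squares of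
the elongations y_e = d_e · (u_a - u_b), where d_e is the vector joining the ends a, b of the spring
e. Suppose that the stresses in equilibrium at the internal nodes form a line ℝs, and that s exerts
the forces f on the terminals. By virtual work ∑ s_e y_e = f · u_B, and by linear duality this is
the only constraint on y once u_B is fixed. The minimum of ∑ y_e² is therefore (f · u_B)² / ∑ s_e²,
so that W = c f fᵀ with c = 1 / ∑ s_e² (`frameNetwork_isResponseMatrix`). What remains is to build a
planar frame with such a line of stresses (`IsRankOne`).

Crossings do no harm in general position: if the point where two transverse bars cross becomes a
node, its equilibrium forces the tension to continue unchanged along each bar, so the stresses stay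
the same (`Generic.cut`, `IsRankOne.cut`, `exists_planar`).

For the construction, every nonzero f_i is resolved along two bars, the hangers, to nearby nodes.
The forces at the hanger nodes are collected along a chain that starts with a tension κ in a bar
from a node y to the first hanger node. At a hanger node v the total force g runs through a short
bar along its own line of action to a new node z, and splits there between a bar to the next hanger
node and a bar to a common support o (`Carry.step`). Each new tension is determined by the earlier
ones, so one free factor survives. The chain ends at y; since f is balanced, the forces left on o
and y are opposite and act along the line oy, and one more bar cancels them
(`Carry.exists_isRankOne`).

The forces in the chain must never point along a line to another node or terminal. The moment of the
force about o does not change at z, and a suitable κ keeps all these moments nonzero; then only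
finitely many directions of z, seen from the next hanger node, are forbidden
(`Carry.exists_closed`). -/

/-! ### Cross product and segments in the plane. -/

theorem wedge_add_left (u v w : Plane) : wedge (u + v) w = wedge u w + wedge v w := by
  simp [wedge]; ring

theorem wedge_add_right (u v w : Plane) : wedge u (v + w) = wedge u v + wedge u w := by
  simp [wedge]; ring

theorem wedge_sub_left (u v w : Plane) : wedge (u - v) w = wedge u w - wedge v w := by
  simp [wedge]; ring

theorem wedge_smul_left (a : ℝ) (u v : Plane) : wedge (a • u) v = a * wedge u v := by
  simp [wedge]; ring

theorem wedge_smul_right (a : ℝ) (u v : Plane) : wedge u (a • v) = a * wedge u v := by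
  simp [wedge]; ring

theorem wedge_neg_left (u v : Plane) : wedge (-u) v = -wedge u v := by
  simp [wedge]; ring

theorem wedge_neg_right (u v : Plane) : wedge u (-v) = -wedge u v := by
  simp [wedge]; ring

@[simp] theorem wedge_self (u : Plane) : wedge u u = 0 := by
  simp [wedge]; ring

@[simp] theorem wedge_zero_left (u : Plane) : wedge 0 u = 0 := by simp [wedge]

@[simp] theorem wedge_zero_right (u : Plane) : wedge u 0 = 0 := by simp [wedge]

theorem wedge_comm_neg (u v : Plane) : wedge u v = -wedge v u := by
  simp [wedge]; ring

theorem plane_ext {u v : Plane} (h0 : u 0 = v 0) (h1 : u 1 = v 1) : u = v := by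
  ext i; fin_cases i <;> assumption

theorem wedge_sum_right {ι : Type*} (t : Finset ι) (u : Plane) (g : ι → Plane) :
    wedge u (∑ i ∈ t, g i) = ∑ i ∈ t, wedge u (g i) := by
  classical
  induction t using Finset.induction_on with
  | empty => simp
  | insert a t ha ih => rw [Finset.sum_insert ha, Finset.sum_insert ha, wedge_add_right, ih]

theorem eq_zero_of_smul_add_smul {p q : Plane} (h : wedge p q ≠ 0) {a b : ℝ}
    (hab : a • p + b • q = 0) : a = 0 ∧ b = 0 := by
  have h1 : wedge (a • p + b • q) q = 0 := by rw [hab]; simp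
  have h2 : wedge p (a • p + b • q) = 0 := by rw [hab]; simp
  simp only [wedge_add_left, wedge_add_right, wedge_smul_left, wedge_smul_right, wedge_self,
    mul_zero, add_zero, zero_add] at h1 h2
  exact ⟨(mul_eq_zero.1 h1).resolve_right h, (mul_eq_zero.1 h2).resolve_right h⟩

theorem exists_eq_smul_add_smul {p q : Plane} (h : wedge p q ≠ 0) (v : Plane) :
    v = (wedge v q / wedge p q) • p + (wedge p v / wedge p q) • q := by
  apply plane_ext <;>
  · simp only [PiLp.add_apply, PiLp.smul_apply, smul_eq_mul]
    field_simp
    simp only [wedge]; ring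

theorem exists_eq_smul_of_wedge_eq_zero {p q : Plane} (hq : q ≠ 0) (h : wedge p q = 0) :
    ∃ c : ℝ, p = c • q := by
  simp only [wedge] at h
  by_cases h0 : q 0 = 0
  · have h1 : q 1 ≠ 0 := fun h1 => hq (plane_ext (by simpa using h0) (by simpa using h1))
    refine ⟨p 1 / q 1, plane_ext ?_ ?_⟩
    · have : p 0 = 0 := by
        rw [h0] at h
        have : p 0 * q 1 = 0 := by linarith
        exact (mul_eq_zero.1 this).resolve_right h1
      simp [this, h0]
    · simp [h1]
  · refine ⟨p 0 / q 0, plane_ext ?_ ?_⟩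
    · simp [h0]
    · simp only [PiLp.smul_apply, smul_eq_mul]
      field_simp
      linarith

theorem mem_openSegment_iff {a b q : Plane} :
    q ∈ openSegment ℝ a b ↔ ∃ θ : ℝ, 0 < θ ∧ θ < 1 ∧ q = a + θ • (b - a) := by
  rw [openSegment_eq_image']
  constructor
  · rintro ⟨θ, ⟨h0, h1⟩, rfl⟩
    exact ⟨θ, h0, h1, rfl⟩
  · rintro ⟨θ, h0, h1, rfl⟩
    exact ⟨θ, ⟨h0, h1⟩, rfl⟩

theorem wedge_of_mem_openSegment {a b q : Plane} (h : q ∈ openSegment ℝ a b) :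
    wedge (q - a) (b - a) = 0 := by
  obtain ⟨θ, -, -, rfl⟩ := mem_openSegment_iff.1 h
  simp [wedge_smul_left]

/-- A point of the open segment from `z` to `b` is collinear with `b` and `z`. -/
theorem wedge_right_of_mem_openSegment {z b q : Plane} (h : q ∈ openSegment ℝ z b) :
    wedge (z - b) (q - b) = 0 := by
  obtain ⟨θ, -, -, rfl⟩ := mem_openSegment_iff.1 h
  have : z + θ • (b - z) - b = (1 - θ) • (z - b) := by module
  rw [this, wedge_smul_right, wedge_self, mul_zero]

/-! ### General position by small parameters. -/

/-- A nonzero affine function has at most one zero. Stating this for all small `t > 0` lets finitely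
many such conditions be met by one `t`. -/
theorem eventually_affine_ne_zero {a b : ℝ} (h : a ≠ 0 ∨ b ≠ 0) :
    ∀ᶠ t in nhdsWithin (0 : ℝ) (Set.Ioi 0), a + t * b ≠ 0 := by
  by_cases ha : a = 0
  · have hb : b ≠ 0 := h.resolve_left (not_not.2 ha)
    filter_upwards [self_mem_nhdsWithin] with t (ht : 0 < t)
    rw [ha, zero_add]
    exact mul_ne_zero ht.ne' hb
  · have hc : ContinuousAt (fun t : ℝ => a + t * b) 0 := by fun_prop
    exact (hc.eventually_ne (by simpa using ha)).filter_mono nhdsWithin_le_nhds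

/-- A line through `b` that does not contain the ray from `w` in the direction `h`. -/
theorem eventually_ray_wedge_ne_zero {w h b v : Plane} (hb : wedge h (b - w) ≠ 0) (hv : v ≠ 0) :
    ∀ᶠ t in nhdsWithin (0 : ℝ) (Set.Ioi 0), wedge (w + t • h - b) v ≠ 0 := by
  -- If both coefficients vanished, `w - b` and `h` would both be parallel to `v`, hence to each
  -- other.
  have h1 : wedge (w - b) v ≠ 0 ∨ wedge h v ≠ 0 := by
    by_contra hcon
    push Not at hcon
    obtain ⟨c, hc⟩ := exists_eq_smul_of_wedge_eq_zero hv hcon.1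
    obtain ⟨d, hd⟩ := exists_eq_smul_of_wedge_eq_zero hv hcon.2
    apply hb
    rw [← neg_sub w b, hc, hd]
    simp [wedge_neg_right, wedge_smul_left, wedge_smul_right]
  filter_upwards [eventually_affine_ne_zero h1] with t ht
  have : w + t • h - b = (w - b) + t • h := by abel
  rwa [this, wedge_add_left, wedge_smul_left]

/-- An open set minus finitely many lines is nonempty. -/
theorem exists_mem_forall_wedge_ne_zero {U : Set Plane} (hU : IsOpen U) {x₀ : Plane}
    (hx₀ : x₀ ∈ U) {L : Set (Plane × Plane)} (hL : L.Finite) :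
    ∃ a ∈ U, ∀ l ∈ L, l.2 ≠ 0 → wedge (a - l.1) l.2 ≠ 0 := by
  -- Points are sought on the parabola `x₀ + (t, t²)`, which contains no segment: on it each line
  -- condition is a nonzero polynomial of degree at most 2 in `t`.
  have hc : Continuous (fun t : ℝ => x₀ + (WithLp.toLp 2 ![t, t ^ 2] : Plane)) := by
    refine continuous_const.add ((PiLp.continuous_toLp 2 _).comp ?_)
    refine continuous_pi fun i => ?_
    fin_cases i <;> simp <;> fun_prop
  have h0 : (WithLp.toLp 2 ![(0 : ℝ), 0 ^ 2] : Plane) = 0 := by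
    apply plane_ext <;> simp
  have hUe : ∀ᶠ t in nhdsWithin (0 : ℝ) (Set.Ioi 0),
      x₀ + (WithLp.toLp 2 ![t, t ^ 2] : Plane) ∈ U := by
    have := hc.continuousAt (x := 0)
    refine (this.eventually (hU.mem_nhds ?_)).filter_mono nhdsWithin_le_nhds
    simpa only [h0, add_zero] using hx₀
  have hLe : ∀ᶠ t in nhdsWithin (0 : ℝ) (Set.Ioi 0), ∀ l ∈ L, l.2 ≠ 0 →
      wedge (x₀ + (WithLp.toLp 2 ![t, t ^ 2] : Plane) - l.1) l.2 ≠ 0 := by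
    refine (Filter.eventually_all_finite hL).2 fun l _ => ?_
    by_cases hl : l.2 = 0
    · exact Filter.Eventually.of_forall fun t h => absurd hl h
    have key : ∀ t : ℝ, wedge (x₀ + (WithLp.toLp 2 ![t, t ^ 2] : Plane) - l.1) l.2 =
        wedge (x₀ - l.1) l.2 + t * (l.2 1 + t * (- l.2 0)) := by
      intro t; simp [wedge]; ring
    simp only [key]
    by_cases h1 : wedge (x₀ - l.1) l.2 = 0
    · have h2 : l.2 1 ≠ 0 ∨ - l.2 0 ≠ 0 := by
        by_contra hcon
        push Not at hcon
        exact hl (plane_ext (by simpa using hcon.2) (by simpa using hcon.1))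
      filter_upwards [eventually_affine_ne_zero h2, self_mem_nhdsWithin] with t ht (ht0 : 0 < t) _
      rw [h1, zero_add]
      exact mul_ne_zero ht0.ne' ht
    · have hc : ContinuousAt (fun t : ℝ => wedge (x₀ - l.1) l.2 + t * (l.2 1 + t * (- l.2 0))) 0 := by
        fun_prop
      filter_upwards [(hc.eventually_ne (by simpa using h1)).filter_mono nhdsWithin_le_nhds]
        with t ht _ using ht
  obtain ⟨t, h1, h2⟩ := (hUe.and hLe).exists
  exact ⟨_, h1, h2⟩

/-! ### Bar frames, their stresses and general position. -/

section Frames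

open scoped Classical

/-- The nodes of a bar frame: terminals, and internal nodes, which are identified with their
positions. -/
abbrev FrameNode (p : ℕ) : Type := Fin p ⊕ Plane

/-- The bars of a frame, with an (irrelevant) orientation. -/
abbrev Bar (p : ℕ) : Type := FrameNode p × FrameNode p

variable {p : ℕ} (x : Fin p → Plane)

/-- The position of a node. -/
def nodePos : FrameNode p → Plane := Sum.elim x id

@[simp] theorem nodePos_inl (i : Fin p) : nodePos x (Sum.inl i) = x i := rfl

@[simp] theorem nodePos_inr (z : Plane) : nodePos x (Sum.inr z) = z := rfl

/-- The relative interior of a bar. -/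
def barSeg (e : Bar p) : Set Plane := openSegment ℝ (nodePos x e.1) (nodePos x e.2)

/-- The vector joining the ends of a bar. -/
def barDir (e : Bar p) : Plane := nodePos x e.2 - nodePos x e.1

/-- The forces exerted on the nodes by a bar under unit tension (per unit length). -/
noncomputable def barLoad (e : Bar p) (v : FrameNode p) : Plane :=
  (if v = e.1 then barDir x e else 0) - (if v = e.2 then barDir x e else 0)

/-- The total forces exerted on the nodes by the bars of `G` under the tensions `s`. -/
noncomputable def netLoad (G : Finset (Bar p)) (s : Bar p → ℝ) (v : FrameNode p) : Plane :=
  ∑ e ∈ G, s e • barLoad x e v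

/-- The elongation of a bar, up to sign and normalization. -/
noncomputable def elongation (U : FrameNode p → Plane) (e : Bar p) : ℝ :=
  inner ℝ (barDir x e) (U e.1 - U e.2)

/-- `a` is a terminal or one of the internal nodes `S`. -/
def IsNode (S : Finset Plane) (a : FrameNode p) : Prop := ∀ z, a = Sum.inr z → z ∈ S

/-- A frame with internal nodes `S` and bars `G` is in general position with respect to the finite
set `F` (which contains the terminals). -/
structure Generic (F S : Finset Plane) (G : Finset (Bar p)) : Prop where
  terminal_mem : ∀ i, x i ∈ F
  notMem : ∀ z ∈ S, z ∉ F
  left : ∀ e ∈ G, IsNode S e.1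
  right : ∀ e ∈ G, IsNode S e.2
  ne : ∀ e ∈ G, nodePos x e.1 ≠ nodePos x e.2
  avoid : ∀ e ∈ G, ∀ q ∈ S ∪ F, q ∉ barSeg x e
  transverse : ∀ e ∈ G, ∀ e' ∈ G, e ≠ e' → ∀ q ∈ barSeg x e, q ∈ barSeg x e' →
    wedge (barDir x e) (barDir x e') ≠ 0
  triple : ∀ e ∈ G, ∀ e' ∈ G, ∀ e'' ∈ G, e ≠ e' → e ≠ e'' → e' ≠ e'' →
    ∀ q ∈ barSeg x e, q ∈ barSeg x e' → q ∉ barSeg x e''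

/-- The stresses of the frame that are in equilibrium at the internal nodes are the multiples of
the stress `s`, which exerts the forces `f` on the terminals. -/
structure IsRankOne (f : Fin p → Plane) (S : Finset Plane) (G : Finset (Bar p)) (s : Bar p → ℝ) :
    Prop where
  internal : ∀ z ∈ S, netLoad x G s (Sum.inr z) = 0
  terminal : ∀ i, netLoad x G s (Sum.inl i) = f i
  unique : ∀ s' : Bar p → ℝ, (∀ z ∈ S, netLoad x G s' (Sum.inr z) = 0) →
    ∃ c : ℝ, ∀ e ∈ G, s' e = c * s e

variable {x}

/-- The two orientations of a bar share their midpoint but are parallel, against `transverse`. Hence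
no spring is counted twice in the energy. -/
theorem Generic.swap_notMem {F S : Finset Plane} {G : Finset (Bar p)} (h : Generic x F S G)
    {a b : FrameNode p} (hab : (a, b) ∈ G) : (b, a) ∉ G := by
  intro hba
  have hne := h.ne _ hab
  have h1 : (1 / 2 : ℝ) • nodePos x a + (1 / 2 : ℝ) • nodePos x b ∈ barSeg x (a, b) :=
    ⟨1 / 2, 1 / 2, by norm_num, by norm_num, by norm_num, rfl⟩
  have h2 : (1 / 2 : ℝ) • nodePos x a + (1 / 2 : ℝ) • nodePos x b ∈ barSeg x (b, a) :=
    ⟨1 / 2, 1 / 2, by norm_num, by norm_num, by norm_num, add_comm _ _⟩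
  refine h.transverse _ hab _ hba ?_ _ h1 h2 ?_
  · intro heq
    simp only [Prod.mk.injEq] at heq
    exact hne (by rw [heq.1])
  · have : barDir x (a, b) = -barDir x (b, a) := by simp [barDir]
    rw [this, wedge_neg_left, wedge_self, neg_zero]

theorem Generic.subset {F S : Finset Plane} {G G' : Finset (Bar p)} (h : Generic x F S G)
    (hG : G' ⊆ G) : Generic x F S G' where
  terminal_mem := h.terminal_mem
  notMem := h.notMem
  left e he := h.left e (hG he)
  right e he := h.right e (hG he)
  ne e he := h.ne e (hG he)
  avoid e he := h.avoid e (hG he)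
  transverse e he e' he' := h.transverse e (hG he) e' (hG he')
  triple e he e' he' e'' he'' := h.triple e (hG he) e' (hG he') e'' (hG he'')

theorem sum_bars_eq {ι : Type*} [Fintype ι] {j : ι → FrameNode p} (hj : Function.Injective j)
    {G : Finset (Bar p)} (hG : ∀ e ∈ G, (∃ a, j a = e.1) ∧ ∃ b, j b = e.2) (Q : Bar p → ℝ) :
    ∑ a, ∑ b, (if (j a, j b) ∈ G then Q (j a, j b) else 0) = ∑ e ∈ G, Q e := by
  rw [← Fintype.sum_prod_type' (f := fun a b => if (j a, j b) ∈ G then Q (j a, j b) else 0)]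
  trans ∑ ab ∈ Finset.univ.filter (fun ab : ι × ι => (j ab.1, j ab.2) ∈ G), Q (j ab.1, j ab.2)
  · rw [Finset.sum_filter]
    exact Finset.sum_congr rfl fun ab _ => by congr
  refine Finset.sum_nbij (fun ab => (j ab.1, j ab.2)) ?_ ?_ ?_ ?_
  · intro ab hab
    exact (Finset.mem_filter.1 hab).2
  · rintro ⟨a, b⟩ - ⟨a', b'⟩ - h
    simp only [Prod.mk.injEq] at h
    rw [hj h.1, hj h.2]
  · rintro ⟨a, b⟩ he
    obtain ⟨⟨a', ha⟩, b', hb⟩ := hG _ he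
    refine ⟨(a', b'), ?_, ?_⟩
    · simp only [Finset.coe_filter, Finset.mem_univ, true_and, Set.mem_ofPred_eq]
      rw [ha, hb]; exact he
    · simp only [ha, hb]
  · intro _ _; rfl

/-! ### Virtual work and the duality of stresses and elongations. -/

/-- Interchange the sums over nodes and bars: a bar acts on its two ends by opposite forces. The map
`j` selects finitely many nodes, including all ends of bars, because the type of nodes is infinite.
-/
theorem netLoad_virtual_work {ι : Type*} [Fintype ι] {j : ι → FrameNode p}
    (hj : Function.Injective j) {G : Finset (Bar p)}
    (hG : ∀ e ∈ G, (∃ a, j a = e.1) ∧ ∃ b, j b = e.2) (s : Bar p → ℝ) (U : FrameNode p → Plane) :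
    ∑ a, inner ℝ (netLoad x G s (j a)) (U (j a)) = ∑ e ∈ G, s e * elongation x U e := by
  simp only [netLoad, sum_inner, inner_smul_left]
  rw [Finset.sum_comm]
  refine Finset.sum_congr rfl fun e he => ?_
  rw [← Finset.mul_sum]
  congr 1
  obtain ⟨⟨a, ha⟩, b, hb⟩ := hG e he
  have key : ∀ (a₀ : ι) (w : Plane),
      ∑ c, inner ℝ (if j c = j a₀ then w else 0) (U (j c)) = inner ℝ w (U (j a₀)) := by
    intro a₀ w
    rw [Finset.sum_eq_single a₀]
    · simp
    · intro c _ hc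
      rw [if_neg fun h => hc (hj h), inner_zero_left]
    · simp
  simp only [barLoad, inner_sub_left, Finset.sum_sub_distrib]
  rw [← ha, ← hb, key, key, elongation, inner_sub_right, ha, hb]

/-- Among the finitely many bars of a frame of rank one, every assignment of elongations that is
orthogonal to the stress is attained by displacements of the internal nodes. -/
theorem IsRankOne.exists_displacement {f : Fin p → Plane} {S : Finset Plane} {G : Finset (Bar p)}
    {s : Bar p → ℝ} (h : IsRankOne x f S G s) (hl : ∀ e ∈ G, IsNode S e.1)
    (hr : ∀ e ∈ G, IsNode S e.2) (y : Bar p → ℝ) (hy : ∑ e ∈ G, s e * y e = 0) :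
    ∃ v : Plane → Plane, ∀ e ∈ G, elongation x (Sum.elim 0 v) e = y e := by
  let R : (Plane → Plane) →ₗ[ℝ] (G → ℝ) :=
    { toFun := fun v e => elongation x (Sum.elim 0 v) e.1
      map_add' := by
        intro v v'
        funext e
        have : ∀ a : FrameNode p, Sum.elim (0 : Fin p → Plane) (v + v') a =
            Sum.elim (0 : Fin p → Plane) v a + Sum.elim (0 : Fin p → Plane) v' a := by
          rintro (i | z) <;> simp
        simp only [elongation, Pi.add_apply, this, ← inner_add_right]
        congr 1; abel
      map_smul' := by
        intro c v
        funext e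
        have : ∀ a : FrameNode p, Sum.elim (0 : Fin p → Plane) (c • v) a =
            c • Sum.elim (0 : Fin p → Plane) v a := by
          rintro (i | z) <;> simp
        simp only [elongation, Pi.smul_apply, this, ← smul_sub, inner_smul_right, RingHom.id_apply,
          smul_eq_mul] }
  suffices hmem : (fun e : G => y e.1) ∈ LinearMap.range R by
    obtain ⟨v, hv⟩ := hmem
    exact ⟨v, fun e he => congrFun hv ⟨e, he⟩⟩
  -- A functional that vanishes on all attainable elongations, but not at `y`, is given by a stress
  -- `s'`. That stress turns out to be in equilibrium, hence a multiple of `s`, which is orthogonal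
  -- to `y`.
  by_contra hcon
  obtain ⟨φ, hφ, hφR⟩ := Submodule.exists_le_ker_of_notMem hcon
  let s' : Bar p → ℝ := fun e => if he : e ∈ G then φ (Pi.single ⟨e, he⟩ 1) else 0
  have hφs : ∀ g : Bar p → ℝ, φ (fun e : G => g e.1) = ∑ e ∈ G, s' e * g e := by
    intro g
    rw [← Finset.sum_coe_sort G]
    conv_lhs => rw [LinearMap.pi_apply_eq_sum_univ φ]
    refine Finset.sum_congr rfl fun e _ => ?_
    simp only [s', e.2, dif_pos, smul_eq_mul]
    rw [mul_comm]
    congr 2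
    funext e'
    simp [Pi.single_apply, eq_comm]
  let j : Fin p ⊕ S → FrameNode p := Sum.map id Subtype.val
  have hj : Function.Injective j := Function.Injective.sumMap Function.injective_id
    Subtype.val_injective
  have hjS : ∀ a : FrameNode p, IsNode S a → ∃ b, j b = a := by
    rintro (i | z) ha
    · exact ⟨Sum.inl i, rfl⟩
    · exact ⟨Sum.inr ⟨z, ha z rfl⟩, rfl⟩
  have hjG : ∀ e ∈ G, (∃ a, j a = e.1) ∧ ∃ b, j b = e.2 :=
    fun e he => ⟨hjS _ (hl e he), hjS _ (hr e he)⟩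
  -- Displacing the node `z` alone, by the very load on it, gives the work `‖load‖²`, which must be
  -- zero.
  have hs' : ∀ z ∈ S, netLoad x G s' (Sum.inr z) = 0 := by
    intro z hz
    have hwork := netLoad_virtual_work (x := x) hj hjG s'
      (Sum.elim 0 (Pi.single z (netLoad x G s' (Sum.inr z))))
    have h0 : φ (R (Pi.single z (netLoad x G s' (Sum.inr z)))) = 0 :=
      hφR (LinearMap.mem_range_self R _)
    have h1 := hφs (elongation x (Sum.elim 0 (Pi.single z (netLoad x G s' (Sum.inr z)))))
    rw [← h1] at hwork
    have h2 : φ (fun e : G => elongation x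
      (Sum.elim 0 (Pi.single z (netLoad x G s' (Sum.inr z)))) e.1) = 0 := h0
    rw [h2, Fintype.sum_sum_type] at hwork
    simp only [j, Sum.map_inl, Sum.map_inr, Sum.elim_inl, Sum.elim_inr, Pi.zero_apply,
      inner_zero_right, Finset.sum_const_zero, zero_add] at hwork
    rw [Finset.sum_eq_single (⟨z, hz⟩ : S)] at hwork
    · simpa using hwork
    · intro b _ hb
      rw [Pi.single_eq_of_ne (fun h => hb (Subtype.ext h)), inner_zero_right]
    · simp
  obtain ⟨c, hc⟩ := h.unique s' hs'
  apply hφ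
  rw [hφs y]
  calc ∑ e ∈ G, s' e * y e = ∑ e ∈ G, c * (s e * y e) :=
        Finset.sum_congr rfl fun e he => by rw [hc e he]; ring
    _ = 0 := by rw [← Finset.mul_sum, hy, mul_zero]

/-! ### The spring network of a frame and its response. -/

theorem stack_dotProduct (f u : Fin p → Plane) :
    dotProduct (stack f) (stack u) = ∑ i, inner ℝ (f i) (u i) := by
  simp only [dotProduct, stack, Fintype.sum_prod_type]
  refine Finset.sum_congr rfl fun i _ => ?_
  simp only [PiLp.inner_apply, RCLike.inner_apply, conj_trivial]
  exact Finset.sum_congr rfl fun a _ => mul_comm _ _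

/-- The network whose internal nodes are `S` and whose springs are the bars of `G`; the spring
constant of a spring is the square of its length. -/
noncomputable def frameNetwork (x : Fin p → Plane) (S : Finset Plane) (G : Finset (Bar p)) :
    ElasticNetwork x where
  numInternal := S.card
  internal := fun j => (S.equivFin.symm j).1
  stiffness := fun i j =>
    if (Sum.map id (fun j => ((S.equivFin.symm j).1 : Plane)) i,
        Sum.map id (fun j => ((S.equivFin.symm j).1 : Plane)) j) ∈ G ∨
      (Sum.map id (fun j => ((S.equivFin.symm j).1 : Plane)) j,
        Sum.map id (fun j => ((S.equivFin.symm j).1 : Plane)) i) ∈ G then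
      ‖Sum.elim x (fun j => (S.equivFin.symm j).1) i -
        Sum.elim x (fun j => (S.equivFin.symm j).1) j‖ ^ 2 else 0
  stiffness_symm := fun i j => by simp only [or_comm, norm_sub_rev]
  stiffness_nonneg := fun i j => by split_ifs <;> positivity
  ne_of_stiffness_pos := fun i j h heq => by simp [heq] at h

/-- The node of the frame that corresponds to a node of the network. -/
noncomputable def frameNode (x : Fin p → Plane) (S : Finset Plane) (G : Finset (Bar p)) :
    (frameNetwork x S G).Node → FrameNode p :=
  Sum.map id fun j => (S.equivFin.symm j).1

theorem frameNode_injective (S : Finset Plane) (G : Finset (Bar p)) :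
    Function.Injective (frameNode x S G) :=
  Function.Injective.sumMap Function.injective_id
    (Subtype.val_injective.comp S.equivFin.symm.injective)

theorem exists_frameNode_eq {S : Finset Plane} (G : Finset (Bar p)) {a : FrameNode p}
    (ha : IsNode S a) : ∃ b, frameNode x S G b = a := by
  rcases a with i | z
  · exact ⟨Sum.inl i, rfl⟩
  · exact ⟨Sum.inr (S.equivFin ⟨z, ha z rfl⟩),
      congrArg (fun q : S => Sum.inr q.1) (S.equivFin.symm_apply_apply ⟨z, ha z rfl⟩)⟩

theorem nodePos_frameNode (S : Finset Plane) (G : Finset (Bar p)) (a : (frameNetwork x S G).Node) :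
    nodePos x (frameNode x S G a) = (frameNetwork x S G).pos a := by
  rcases a with i | j <;> rfl

theorem frameNetwork_stiffness (S : Finset Plane) (G : Finset (Bar p))
    (i j : (frameNetwork x S G).Node) : (frameNetwork x S G).stiffness i j =
      if (frameNode x S G i, frameNode x S G j) ∈ G ∨ (frameNode x S G j, frameNode x S G i) ∈ G
      then ‖(frameNetwork x S G).pos i - (frameNetwork x S G).pos j‖ ^ 2 else 0 := rfl

theorem frameNetwork_spring {S : Finset Plane} {G : Finset (Bar p)}
    {i j : (frameNetwork x S G).Node} (h : (frameNetwork x S G).Spring i j) :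
    (frameNode x S G i, frameNode x S G j) ∈ G ∨ (frameNode x S G j, frameNode x S G i) ∈ G := by
  by_contra hcon
  rw [ElasticNetwork.Spring, frameNetwork_stiffness, if_neg hcon] at h
  exact lt_irrefl _ h

/-- The stiffness, a squared length, cancels the normalization of the direction. Each bar belongs to
two ordered pairs of nodes, which cancels the factor `1 / 2`. -/
theorem frameNetwork_quadForm {F S : Finset Plane} {G : Finset (Bar p)} (hG : Generic x F S G)
    (U : FrameNode p → Plane) :
    (frameNetwork x S G).quadForm (fun a => U (frameNode x S G a)) =
      ∑ e ∈ G, elongation x U e ^ 2 := by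
  have hj := frameNode_injective (x := x) S G
  have hG' : ∀ e ∈ G, (∃ a, frameNode x S G a = e.1) ∧ ∃ b, frameNode x S G b = e.2 :=
    fun e he => ⟨exists_frameNode_eq G (hG.left e he), exists_frameNode_eq G (hG.right e he)⟩
  have hterm : ∀ i j : (frameNetwork x S G).Node, (frameNetwork x S G).stiffness i j *
      (inner ℝ (U (frameNode x S G i) - U (frameNode x S G j))
        ((frameNetwork x S G).pos i - (frameNetwork x S G).pos j) /
        ‖(frameNetwork x S G).pos i - (frameNetwork x S G).pos j‖) ^ 2 =
      (if (frameNode x S G i, frameNode x S G j) ∈ G then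
        elongation x U (frameNode x S G i, frameNode x S G j) ^ 2 else 0) +
      (if (frameNode x S G j, frameNode x S G i) ∈ G then
        elongation x U (frameNode x S G j, frameNode x S G i) ^ 2 else 0) := by
    intro i j
    have hnorm : ∀ a b : (frameNetwork x S G).Node,
        (frameNode x S G a, frameNode x S G b) ∈ G →
        ‖(frameNetwork x S G).pos i - (frameNetwork x S G).pos j‖ ≠ 0 ∨ ¬ (a = i ∧ b = j) ∧
          ¬ (a = j ∧ b = i) := by
      intro a b hab
      have := hG.ne _ hab
      simp only [nodePos_frameNode] at this
      by_cases h1 : a = i ∧ b = j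
      · left; rw [← h1.1, ← h1.2]; exact norm_ne_zero_iff.2 (sub_ne_zero.2 this)
      by_cases h2 : a = j ∧ b = i
      · left; rw [← h2.1, ← h2.2]; exact norm_ne_zero_iff.2 (sub_ne_zero.2 this.symm)
      exact Or.inr ⟨h1, h2⟩
    have hsq : ∀ v w : Plane, ‖v‖ ≠ 0 → ‖v‖ ^ 2 * (inner ℝ w v / ‖v‖) ^ 2 = inner ℝ v w ^ 2 := by
      intro v w hv
      rw [real_inner_comm]
      field_simp
    rw [frameNetwork_stiffness]
    by_cases h1 : (frameNode x S G i, frameNode x S G j) ∈ G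
    · have h2 := hG.swap_notMem h1
      have h3 : ‖(frameNetwork x S G).pos i - (frameNetwork x S G).pos j‖ ≠ 0 :=
        (hnorm i j h1).resolve_right fun h => h.1 ⟨rfl, rfl⟩
      rw [if_pos (Or.inl h1), if_pos h1, if_neg h2, add_zero, hsq _ _ h3, elongation, barDir,
        nodePos_frameNode, nodePos_frameNode, ← neg_sub, inner_neg_left, neg_sq]
    · by_cases h2 : (frameNode x S G j, frameNode x S G i) ∈ G
      · have h3 : ‖(frameNetwork x S G).pos i - (frameNetwork x S G).pos j‖ ≠ 0 :=
          (hnorm j i h2).resolve_right fun h => h.2 ⟨rfl, rfl⟩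
        rw [if_pos (Or.inr h2), if_neg h1, if_pos h2, zero_add, hsq _ _ h3, elongation, barDir,
          nodePos_frameNode, nodePos_frameNode, ← inner_neg_neg, neg_sub, neg_sub,
          ← neg_sub, inner_neg_left, ← inner_neg_right, neg_sub, ← inner_neg_neg, neg_sub, neg_sub,
          ← neg_sub, inner_neg_left, neg_sq]
      · rw [if_neg (not_or.2 ⟨h1, h2⟩), if_neg h1, if_neg h2]; simp
  rw [ElasticNetwork.quadForm]
  simp only [hterm, Finset.sum_add_distrib]
  rw [sum_bars_eq hj hG' fun e => elongation x U e ^ 2, Finset.sum_comm,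
    sum_bars_eq hj hG' fun e => elongation x U e ^ 2]
  ring

theorem frameNetwork_isPlanar {F S : Finset Plane} {G : Finset (Bar p)} (hG : Generic x F S G)
    (hdisj : ∀ e ∈ G, ∀ e' ∈ G, e ≠ e' → Disjoint (barSeg x e) (barSeg x e')) :
    (frameNetwork x S G).IsPlanar where
  internal_injective := Subtype.val_injective.comp S.equivFin.symm.injective
  internal_ne_terminal := fun j i h =>
    hG.notMem _ (S.equivFin.symm j).2 (by
      have : ((S.equivFin.symm j).1 : Plane) = x i := h
      rw [this]; exact hG.terminal_mem i)
  node_notMem := by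
    intro i j l hij
    have hl : (frameNetwork x S G).pos l ∈ S ∪ F := by
      rcases l with i | j
      · exact Finset.mem_union_right _ (hG.terminal_mem i)
      · exact Finset.mem_union_left _ (S.equivFin.symm j).2
    rcases frameNetwork_spring hij with h | h
    · have := hG.avoid _ h _ hl
      simpa only [barSeg, nodePos_frameNode] using this
    · have := hG.avoid _ h _ hl
      rw [openSegment_symm]
      simpa only [barSeg, nodePos_frameNode] using this
  no_crossing := by
    intro i j i' j' hij hij' hne
    have hj := frameNode_injective (x := x) S G
    have key : ∀ a b a' b' : (frameNetwork x S G).Node,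
        (frameNode x S G a, frameNode x S G b) ∈ G → (frameNode x S G a', frameNode x S G b') ∈ G →
        s(a, b) ≠ s(a', b') →
        Disjoint (openSegment ℝ ((frameNetwork x S G).pos a) ((frameNetwork x S G).pos b))
          (openSegment ℝ ((frameNetwork x S G).pos a') ((frameNetwork x S G).pos b')) := by
      intro a b a' b' h h' hs
      have := hdisj _ h _ h' (by
        intro heq
        simp only [Prod.mk.injEq] at heq
        exact hs (by rw [hj heq.1, hj heq.2]))
      simpa only [barSeg, nodePos_frameNode] using this
    rcases frameNetwork_spring hij with h | h <;> rcases frameNetwork_spring hij' with h' | h'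
    · exact key _ _ _ _ h h' hne
    · rw [openSegment_symm ℝ ((frameNetwork x S G).pos i')]
      exact key _ _ _ _ h h' (by rwa [Sym2.eq_swap (a := j')])
    · rw [openSegment_symm ℝ ((frameNetwork x S G).pos i)]
      exact key _ _ _ _ h h' (by rwa [Sym2.eq_swap (a := j)])
    · rw [openSegment_symm ℝ ((frameNetwork x S G).pos i),
        openSegment_symm ℝ ((frameNetwork x S G).pos i')]
      exact key _ _ _ _ h h' (by rwa [Sym2.eq_swap (a := j), Sym2.eq_swap (a := j')])

theorem IsRankOne.sum_sq_pos {f : Fin p → Plane} {S : Finset Plane} {G : Finset (Bar p)}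
    {s : Bar p → ℝ} (h : IsRankOne x f S G s) (hf : f ≠ 0) : 0 < ∑ e ∈ G, s e ^ 2 := by
  refine (Finset.sum_nonneg fun e _ => sq_nonneg (s e)).lt_of_ne' fun h0 => hf ?_
  have hs := (Finset.sum_eq_zero_iff_of_nonneg fun e _ => sq_nonneg (s e)).1 h0
  funext i
  rw [← h.terminal i, netLoad]
  exact Finset.sum_eq_zero fun e he => by rw [pow_eq_zero_iff two_ne_zero |>.1 (hs e he), zero_smul]

/-- The elongations `y` compatible with `u` have the fixed product `∑ s e * y e = T`. Cauchy–Schwarz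
bounds `∑ y e ^ 2` below by `T ^ 2 / Q`, with equality for `y = (T / Q) • s`, which is attained by
duality. -/
theorem frameNetwork_isResponseMatrix {f : Fin p → Plane} {F S : Finset Plane}
    {G : Finset (Bar p)} {s : Bar p → ℝ} (hG : Generic x F S G) (h : IsRankOne x f S G s)
    (hf : f ≠ 0) : (frameNetwork x S G).IsResponseMatrix
      ((∑ e ∈ G, s e ^ 2)⁻¹ • Matrix.vecMulVec (stack f) (stack f)) := by
  set Q := ∑ e ∈ G, s e ^ 2 with hQ
  have hQ0 : 0 < Q := h.sum_sq_pos hf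
  have hG' : ∀ e ∈ G, (∃ a, frameNode x S G a = e.1) ∧ ∃ b, frameNode x S G b = e.2 :=
    fun e he => ⟨exists_frameNode_eq G (hG.left e he), exists_frameNode_eq G (hG.right e he)⟩
  have hwork : ∀ U : FrameNode p → Plane, ∑ e ∈ G, s e * elongation x U e =
      ∑ i, inner ℝ (f i) (U (Sum.inl i)) := by
    intro U
    rw [← netLoad_virtual_work (frameNode_injective (x := x) S G) hG', Fintype.sum_sum_type]
    have h2 : ∀ j, netLoad x G s (frameNode x S G (Sum.inr j)) = 0 :=
      fun j => h.internal _ (S.equivFin.symm j).2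
    simp only [h2, inner_zero_left, Finset.sum_const_zero, add_zero]
    refine Finset.sum_congr rfl fun i _ => ?_
    rw [← h.terminal i]; rfl
  refine ⟨?_, fun u => ?_⟩
  · rw [Matrix.IsSymm, Matrix.transpose_smul]
    congr 1
    ext a b
    simp [Matrix.vecMulVec_apply, mul_comm]
  have hlhs : dotProduct (stack u) ((Q⁻¹ • Matrix.vecMulVec (stack f) (stack f)).mulVec (stack u)) =
      Q⁻¹ * (∑ i, inner ℝ (f i) (u i)) ^ 2 := by
    rw [Matrix.smul_mulVec, dotProduct_smul, Matrix.vecMulVec_mulVec, ← stack_dotProduct]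
    simp only [smul_eq_mul, dotProduct_smul, MulOpposite.smul_eq_mul_unop, MulOpposite.unop_op,
      dotProduct_comm (stack u) (stack f)]
    ring
  rw [hlhs, ElasticNetwork.responseForm]
  set T := ∑ i, inner ℝ (f i) (u i) with hT
  have hlow : ∀ v : Fin S.card → Plane,
      Q⁻¹ * T ^ 2 ≤ (frameNetwork x S G).quadForm (Sum.elim u v) := by
    intro v
    let V : Plane → Plane := fun z => if hz : z ∈ S then v (S.equivFin ⟨z, hz⟩) else 0
    have hV : (Sum.elim u v : (frameNetwork x S G).Node → Plane) =
        fun a => Sum.elim u V (frameNode x S G a) := by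
      funext a
      rcases a with i | j
      · rfl
      · simp only [frameNode, V, Sum.map_inr, Sum.elim_inr, Finset.coe_mem, dif_pos]
        exact (congrArg v (S.equivFin.apply_symm_apply j)).symm
    rw [hV, frameNetwork_quadForm hG]
    have hcs := Finset.sum_mul_sq_le_sq_mul_sq G s (elongation x (Sum.elim u V))
    rw [hwork] at hcs
    simp only [Sum.elim_inl] at hcs
    rw [inv_mul_le_iff₀ hQ0]
    exact hcs
  refine le_antisymm (le_ciInf hlow) ?_
  -- The correction from the elongations at `v = 0` to the optimal ones is orthogonal to `s`, so
  -- displacements of the internal nodes produce it.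
  have h0 : ∑ e ∈ G, s e * (T / Q * s e - elongation x (Sum.elim u 0) e) = 0 := by
    simp only [mul_sub, Finset.sum_sub_distrib]
    rw [hwork]
    simp only [Sum.elim_inl]
    rw [← hT, Finset.sum_congr rfl fun e _ => (by ring : s e * (T / Q * s e) = T / Q * s e ^ 2),
      ← Finset.mul_sum, ← hQ, div_mul_cancel₀ _ hQ0.ne', sub_self]
  obtain ⟨V, hV⟩ := h.exists_displacement hG.left hG.right _ h0
  have hadd : ∀ a : FrameNode p, Sum.elim u V a =
      Sum.elim u (0 : Plane → Plane) a + Sum.elim (0 : Fin p → Plane) V a := by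
    rintro (i | z) <;> simp
  have hV' : ∀ e ∈ G, elongation x (Sum.elim u V) e = T / Q * s e := by
    intro e he
    have h1 := hV e he
    have h2 : elongation x (Sum.elim u V) e = elongation x (Sum.elim u 0) e +
        elongation x (Sum.elim 0 V) e := by
      simp only [elongation, hadd, ← inner_add_right]
      congr 1; abel
    rw [h2, h1]; ring
  refine (ciInf_le ⟨_, Set.forall_mem_range.2 hlow⟩
    (fun j : Fin S.card => V (S.equivFin.symm j).1)).trans ?_
  have hVeq : (Sum.elim u (fun j : Fin S.card => V (S.equivFin.symm j).1) :
      (frameNetwork x S G).Node → Plane) = fun a => Sum.elim u V (frameNode x S G a) := by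
    funext a
    rcases a with i | j <;> rfl
  rw [hVeq, frameNetwork_quadForm hG,
    Finset.sum_congr rfl fun e he => (by rw [hV' e he]; ring :
      elongation x (Sum.elim u V) e ^ 2 = (T / Q) ^ 2 * s e ^ 2), ← Finset.mul_sum, ← hQ]
  apply le_of_eq
  field_simp

/-! ### Turning crossings into nodes. -/

variable (x) in
/-- The points where two bars cross. -/
def crossings (G : Finset (Bar p)) : Set Plane :=
  {q | ∃ e ∈ G, ∃ e' ∈ G, e ≠ e' ∧ q ∈ barSeg x e ∧ q ∈ barSeg x e'}

theorem wedge_sub_barDir {e : Bar p} {q q' : Plane} (h : q ∈ barSeg x e) (h' : q' ∈ barSeg x e) :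
    wedge (q - q') (barDir x e) = 0 := by
  have h1 := wedge_of_mem_openSegment h
  have h2 := wedge_of_mem_openSegment h'
  rw [← sub_sub_sub_cancel_right q q' (nodePos x e.1), wedge_sub_left, barDir, h1, h2, sub_zero]

theorem Generic.crossing_unique {F S : Finset Plane} {G : Finset (Bar p)} (h : Generic x F S G)
    {e e' : Bar p} (he : e ∈ G) (he' : e' ∈ G) (hne : e ≠ e') :
    (barSeg x e ∩ barSeg x e').Subsingleton := by
  rintro q ⟨hq, hq'⟩ r ⟨hr, hr'⟩
  have h1 := wedge_sub_barDir hq hr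
  have h2 := wedge_sub_barDir hq' hr'
  have h3 := h.transverse e he e' he' hne q hq hq'
  have h4 : barDir x e ≠ 0 := fun h0 => h3 (by rw [h0, wedge_zero_left])
  obtain ⟨c, hc⟩ := exists_eq_smul_of_wedge_eq_zero h4 h1
  rw [hc, wedge_smul_left] at h2
  have hc0 : c = 0 := (mul_eq_zero.1 h2).resolve_right h3
  rw [hc0, zero_smul] at hc
  exact sub_eq_zero.1 hc

theorem Generic.crossings_finite {F S : Finset Plane} {G : Finset (Bar p)}
    (h : Generic x F S G) : (crossings x G).Finite := by
  have : crossings x G ⊆ ⋃ e ∈ G, ⋃ e' ∈ G, if e = e' then ∅ else barSeg x e ∩ barSeg x e' := by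
    rintro q ⟨e, he, e', he', hne, hq, hq'⟩
    simp only [Set.mem_iUnion]
    exact ⟨e, he, e', he', by rw [if_neg hne]; exact ⟨hq, hq'⟩⟩
  refine Set.Finite.subset ?_ this
  refine G.finite_toSet.biUnion fun e he => G.finite_toSet.biUnion fun e' he' => ?_
  split_ifs with hee
  · exact Set.finite_empty
  · exact (h.crossing_unique he he' hee).finite

theorem IsNode.mono {S S' : Finset Plane} (h : S ⊆ S') {a : FrameNode p} (ha : IsNode S a) :
    IsNode S' a := fun z hz => h (ha z hz)

theorem isNode_inl (S : Finset Plane) (i : Fin p) : IsNode S (Sum.inl i : FrameNode p) :=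
  fun _ h => by cases h

theorem isNode_inr {S : Finset Plane} {z : Plane} (h : z ∈ S) :
    IsNode S (Sum.inr z : FrameNode p) := fun _ h' => by cases h'; exact h

theorem Generic.nodePos_mem {F S : Finset Plane} {G : Finset (Bar p)} (h : Generic x F S G)
    {a : FrameNode p} (ha : IsNode S a) : nodePos x a ∈ S ∪ F := by
  rcases a with i | z
  · exact Finset.mem_union_right _ (h.terminal_mem i)
  · exact Finset.mem_union_left _ (ha z rfl)

/-- The two halves of a bar that is cut at the interior point `z`. -/
theorem halves_of_mem_barSeg {e : Bar p} {z : Plane} (hz : z ∈ barSeg x e) :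
    ∃ θ : ℝ, 0 < θ ∧ θ < 1 ∧
      barDir x (Sum.inr z, e.1) = (-θ) • barDir x e ∧
      barDir x (Sum.inr z, e.2) = (1 - θ) • barDir x e ∧
      barSeg x (Sum.inr z, e.1) ⊆ barSeg x e ∧ barSeg x (Sum.inr z, e.2) ⊆ barSeg x e ∧
      (nodePos x e.1 ≠ nodePos x e.2 →
        z ∉ barSeg x (Sum.inr z, e.1) ∧ z ∉ barSeg x (Sum.inr z, e.2) ∧
        Disjoint (barSeg x (Sum.inr z, e.1)) (barSeg x (Sum.inr z, e.2))) := by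
  obtain ⟨θ, h0, h1, hθ⟩ := mem_openSegment_iff.1 hz
  have hz' : z = nodePos x e.1 + θ • barDir x e := hθ
  have e1 : barDir x (Sum.inr z, e.1) = (-θ) • barDir x e := by
    simp only [barDir, nodePos_inr] at hz' ⊢
    rw [hz']; module
  have e2 : barDir x (Sum.inr z, e.2) = (1 - θ) • barDir x e := by
    simp only [barDir, nodePos_inr] at hz' ⊢
    rw [hz']; module
  have m1 : ∀ q, q ∈ barSeg x (Sum.inr z, e.1) →
      ∃ τ : ℝ, 0 < τ ∧ τ < θ ∧ q = nodePos x e.1 + τ • barDir x e := by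
    intro q hq
    obtain ⟨τ, t0, t1, ht⟩ := mem_openSegment_iff.1 hq
    refine ⟨θ * (1 - τ), by nlinarith, by nlinarith, ?_⟩
    change q = z + τ • barDir x (Sum.inr z, e.1) at ht
    rw [ht, e1, hz']; module
  have m2 : ∀ q, q ∈ barSeg x (Sum.inr z, e.2) →
      ∃ τ : ℝ, θ < τ ∧ τ < 1 ∧ q = nodePos x e.1 + τ • barDir x e := by
    intro q hq
    obtain ⟨τ, t0, t1, ht⟩ := mem_openSegment_iff.1 hq
    refine ⟨θ + τ * (1 - θ), by nlinarith, by nlinarith, ?_⟩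
    change q = z + τ • barDir x (Sum.inr z, e.2) at ht
    rw [ht, e2, hz']; module
  refine ⟨θ, h0, h1, e1, e2, ?_, ?_, fun hne => ?_⟩
  · intro q hq
    obtain ⟨τ, t0, t1, ht⟩ := m1 q hq
    exact mem_openSegment_iff.2 ⟨τ, t0, t1.trans h1, ht⟩
  · intro q hq
    obtain ⟨τ, t0, t1, ht⟩ := m2 q hq
    exact mem_openSegment_iff.2 ⟨τ, h0.trans t0, t1, ht⟩
  have hd : barDir x e ≠ 0 := sub_ne_zero.2 hne.symm
  have inj : ∀ τ τ' : ℝ, nodePos x e.1 + τ • barDir x e = nodePos x e.1 + τ' • barDir x e →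
      τ = τ' := fun τ τ' h => smul_left_injective ℝ hd (add_left_cancel h)
  refine ⟨fun hq => ?_, fun hq => ?_, Set.disjoint_left.2 fun q hq hq' => ?_⟩
  · obtain ⟨τ, t0, t1, ht⟩ := m1 z hq
    exact t1.ne' (inj _ _ (hz'.symm.trans ht))
  · obtain ⟨τ, t0, t1, ht⟩ := m2 z hq
    exact t0.ne (inj _ _ (hz'.symm.trans ht))
  · obtain ⟨τ, t0, t1, ht⟩ := m1 q hq
    obtain ⟨τ', t0', t1', ht'⟩ := m2 q hq'
    exact (t1.trans t0').ne (inj _ _ (ht.symm.trans ht'))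

/-- The bars of a frame after two crossing bars have been cut at the point `z`. -/
noncomputable def cutBars (G : Finset (Bar p)) (e₁ e₂ : Bar p) (z : Plane) : Finset (Bar p) :=
  insert (Sum.inr z, e₁.1) (insert (Sum.inr z, e₁.2) (insert (Sum.inr z, e₂.1)
    (insert (Sum.inr z, e₂.2) ((G.erase e₁).erase e₂))))

theorem mem_cutBars {G : Finset (Bar p)} {e₁ e₂ : Bar p} {z : Plane} {e : Bar p} :
    e ∈ cutBars G e₁ e₂ z ↔ (e ∈ G ∧ e ≠ e₁ ∧ e ≠ e₂) ∨
      (e = (Sum.inr z, e₁.1) ∨ e = (Sum.inr z, e₁.2)) ∨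
      (e = (Sum.inr z, e₂.1) ∨ e = (Sum.inr z, e₂.2)) := by
  simp only [cutBars, Finset.mem_insert, Finset.mem_erase]
  tauto

/-- The new bars lie inside old ones, so general position is inherited. By `triple` no third bar
passes through `z`, so this crossing disappears; by `avoid`, which also covers `F`, the new node is
not a forbidden point. -/
theorem Generic.cut {F S : Finset Plane} {G : Finset (Bar p)} (h : Generic x F S G)
    {e₁ e₂ : Bar p} (he₁ : e₁ ∈ G) (he₂ : e₂ ∈ G) (hne : e₁ ≠ e₂) {z : Plane}
    (hz₁ : z ∈ barSeg x e₁) (hz₂ : z ∈ barSeg x e₂) :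
    Generic x F (insert z S) (cutBars G e₁ e₂ z) ∧
      crossings x (cutBars G e₁ e₂ z) ⊆ crossings x G \ {z} := by
  -- Every new bar has a parent in `G` that contains it and is parallel to it. Two new bars that
  -- meet have different parents, as the halves of one bar are disjoint.
  have hpar : ∀ e ∈ cutBars G e₁ e₂ z, ∃ P ∈ G, barSeg x e ⊆ barSeg x P ∧
      (∃ k : ℝ, k ≠ 0 ∧ barDir x e = k • barDir x P) ∧
      ((e ≠ e₁ ∧ e ≠ e₂ ∧ P = e) ∨
        (P = e₁ ∧ (e = (Sum.inr z, e₁.1) ∨ e = (Sum.inr z, e₁.2))) ∨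
        (P = e₂ ∧ (e = (Sum.inr z, e₂.1) ∨ e = (Sum.inr z, e₂.2)))) := by
    intro e he
    obtain ⟨θ, t0, t1, a1, a2, a3, a4, -⟩ := halves_of_mem_barSeg hz₁
    obtain ⟨η, u0, u1, b1, b2, b3, b4, -⟩ := halves_of_mem_barSeg hz₂
    rcases mem_cutBars.1 he with ⟨h1, h2, h3⟩ | (rfl | rfl) | (rfl | rfl)
    · exact ⟨e, h1, subset_rfl, ⟨1, one_ne_zero, (one_smul _ _).symm⟩, Or.inl ⟨h2, h3, rfl⟩⟩
    · exact ⟨e₁, he₁, a3, ⟨-θ, by linarith, a1⟩, Or.inr (Or.inl ⟨rfl, Or.inl rfl⟩)⟩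
    · exact ⟨e₁, he₁, a4, ⟨1 - θ, by linarith, a2⟩, Or.inr (Or.inl ⟨rfl, Or.inr rfl⟩)⟩
    · exact ⟨e₂, he₂, b3, ⟨-η, by linarith, b1⟩, Or.inr (Or.inr ⟨rfl, Or.inl rfl⟩)⟩
    · exact ⟨e₂, he₂, b4, ⟨1 - η, by linarith, b2⟩, Or.inr (Or.inr ⟨rfl, Or.inr rfl⟩)⟩
  obtain ⟨-, -, -, -, -, -, -, hh₁⟩ := halves_of_mem_barSeg hz₁
  obtain ⟨-, -, -, -, -, -, -, hh₂⟩ := halves_of_mem_barSeg hz₂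
  obtain ⟨c1, c2, c3⟩ := hh₁ (h.ne _ he₁)
  obtain ⟨d1, d2, d3⟩ := hh₂ (h.ne _ he₂)
  choose! par hparG hparS hparD hparC using hpar
  have hzseg : ∀ e ∈ cutBars G e₁ e₂ z, z ∉ barSeg x e := by
    intro e he
    rcases mem_cutBars.1 he with ⟨h1, h2, h3⟩ | (rfl | rfl) | (rfl | rfl)
    · exact h.triple e₁ he₁ e₂ he₂ e h1 hne h2.symm h3.symm z hz₁ hz₂
    all_goals assumption
  have hzS : z ∉ S ∪ F := fun hzS => h.avoid e₁ he₁ z hzS hz₁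
  have hdisj : ∀ e ∈ cutBars G e₁ e₂ z, ∀ e' ∈ cutBars G e₁ e₂ z, e ≠ e' → par e = par e' →
      Disjoint (barSeg x e) (barSeg x e') := by
    intro e he e' he' hee hpp
    rcases hparC e he with ⟨h1, h2, h3⟩ | ⟨h1, h2⟩ | ⟨h1, h2⟩ <;>
    rcases hparC e' he' with ⟨h1', h2', h3'⟩ | ⟨h1', h2'⟩ | ⟨h1', h2'⟩
    · exact absurd (h3.symm.trans (hpp.trans h3')) hee
    · exact absurd (h3.symm.trans (hpp.trans h1')) h1
    · exact absurd (h3.symm.trans (hpp.trans h1')) h2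
    · exact absurd (h3'.symm.trans (hpp.symm.trans h1)) h1'
    · rcases h2 with rfl | rfl <;> rcases h2' with rfl | rfl
      · exact absurd rfl hee
      · exact c3
      · exact c3.symm
      · exact absurd rfl hee
    · exact absurd (h1.symm.trans (hpp.trans h1')) hne
    · exact absurd (h3'.symm.trans (hpp.symm.trans h1)) h2'
    · exact absurd (h1'.symm.trans (hpp.symm.trans h1)) hne
    · rcases h2 with rfl | rfl <;> rcases h2' with rfl | rfl
      · exact absurd rfl hee
      · exact d3
      · exact d3.symm
      · exact absurd rfl hee
  have hparNe : ∀ e ∈ cutBars G e₁ e₂ z, ∀ e' ∈ cutBars G e₁ e₂ z, e ≠ e' → ∀ q ∈ barSeg x e,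
      q ∈ barSeg x e' → par e ≠ par e' := fun e he e' he' hee q hq hq' hpp =>
    Set.disjoint_left.1 (hdisj e he e' he' hee hpp) hq hq'
  refine ⟨⟨h.terminal_mem, ?_, ?_, ?_, ?_, ?_, ?_, ?_⟩, ?_⟩
  · intro w hw
    rcases Finset.mem_insert.1 hw with rfl | hw
    · exact fun hF => hzS (Finset.mem_union_right _ hF)
    · exact h.notMem w hw
  · intro e he
    rcases mem_cutBars.1 he with ⟨h1, -⟩ | (rfl | rfl) | (rfl | rfl)
    · exact (h.left e h1).mono (Finset.subset_insert _ _)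
    all_goals exact isNode_inr (Finset.mem_insert_self _ _)
  · intro e he
    rcases mem_cutBars.1 he with ⟨h1, -⟩ | (rfl | rfl) | (rfl | rfl)
    · exact (h.right e h1).mono (Finset.subset_insert _ _)
    · exact (h.left e₁ he₁).mono (Finset.subset_insert _ _)
    · exact (h.right e₁ he₁).mono (Finset.subset_insert _ _)
    · exact (h.left e₂ he₂).mono (Finset.subset_insert _ _)
    · exact (h.right e₂ he₂).mono (Finset.subset_insert _ _)
  · intro e he heq
    obtain ⟨k, hk, hd⟩ := hparD e he
    have : barDir x e = 0 := by rw [barDir, heq, sub_self]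
    rw [this] at hd
    have := (smul_eq_zero.1 hd.symm).resolve_left hk
    exact h.ne _ (hparG e he) (sub_eq_zero.1 this).symm
  · intro e he q hq
    rw [Finset.insert_union] at hq
    rcases Finset.mem_insert.1 hq with rfl | hq
    · exact hzseg e he
    · exact fun hqe => h.avoid _ (hparG e he) q hq (hparS e he hqe)
  · intro e he e' he' hee q hq hq'
    obtain ⟨k, hk, hd⟩ := hparD e he
    obtain ⟨k', hk', hd'⟩ := hparD e' he'
    rw [hd, hd', wedge_smul_left, wedge_smul_right]
    exact mul_ne_zero hk (mul_ne_zero hk' (h.transverse _ (hparG e he) _ (hparG e' he')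
      (hparNe e he e' he' hee q hq hq') q (hparS e he hq) (hparS e' he' hq')))
  · intro e he e' he' e'' he'' n1 n2 n3 q hq hq' hq''
    exact h.triple _ (hparG e he) _ (hparG e' he') _ (hparG e'' he'')
      (hparNe e he e' he' n1 q hq hq') (hparNe e he e'' he'' n2 q hq hq'')
      (hparNe e' he' e'' he'' n3 q hq' hq'') q (hparS e he hq) (hparS e' he' hq')
      (hparS e'' he'' hq'')
  · rintro q ⟨e, he, e', he', hee, hq, hq'⟩
    refine ⟨⟨_, hparG e he, _, hparG e' he', hparNe e he e' he' hee q hq hq', hparS e he hq,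
      hparS e' he' hq'⟩, ?_⟩
    rintro rfl
    exact hzseg e he hq

theorem barLoad_half_left {e : Bar p} {z : Plane} {k : ℝ}
    (hk : barDir x (Sum.inr z, e.1) = (-k) • barDir x e) (v : FrameNode p) :
    barLoad x (Sum.inr z, e.1) v = k • ((if v = e.1 then barDir x e else 0) -
      (if v = Sum.inr z then barDir x e else 0)) := by
  simp only [barLoad, hk]
  split_ifs <;> module

theorem barLoad_half_right {e : Bar p} {z : Plane} {k : ℝ}
    (hk : barDir x (Sum.inr z, e.2) = k • barDir x e) (v : FrameNode p) :
    barLoad x (Sum.inr z, e.2) v = k • ((if v = Sum.inr z then barDir x e else 0) -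
      (if v = e.2 then barDir x e else 0)) := by
  simp only [barLoad, hk]
  split_ifs <;> module

theorem netLoad_insert {G : Finset (Bar p)} {e : Bar p} (he : e ∉ G) (s : Bar p → ℝ)
    (v : FrameNode p) : netLoad x (insert e G) s v = s e • barLoad x e v + netLoad x G s v :=
  Finset.sum_insert he

theorem netLoad_congr {G : Finset (Bar p)} {s s' : Bar p → ℝ} (h : ∀ e ∈ G, s e = s' e)
    (v : FrameNode p) : netLoad x G s v = netLoad x G s' v :=
  Finset.sum_congr rfl fun e he => by rw [h e he]

/-- Equilibrium at `z` is a relation between two independent directions, so the two halves of each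
bar carry the same tension. Stresses before and after the cut thus correspond to each other, with
the same loads. -/
theorem IsRankOne.cut {f : Fin p → Plane} {F S : Finset Plane} {G : Finset (Bar p)}
    {s : Bar p → ℝ} (hs : IsRankOne x f S G s) (h : Generic x F S G)
    {e₁ e₂ : Bar p} (he₁ : e₁ ∈ G) (he₂ : e₂ ∈ G) (hne : e₁ ≠ e₂) {z : Plane}
    (hz₁ : z ∈ barSeg x e₁) (hz₂ : z ∈ barSeg x e₂) :
    ∃ s', IsRankOne x f (insert z S) (cutBars G e₁ e₂ z) s' := by
  have htr := h.transverse _ he₁ _ he₂ hne z hz₁ hz₂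
  obtain ⟨θ, t0, t1, a1, a2, -⟩ := halves_of_mem_barSeg hz₁
  obtain ⟨η, u0, u1, b1, b2, -⟩ := halves_of_mem_barSeg hz₂
  have t1' : 1 - θ ≠ 0 := by linarith
  have u1' : 1 - η ≠ 0 := by linarith
  have hzS : z ∉ S ∪ F := fun hzS => h.avoid e₁ he₁ z hzS hz₁
  have hzN : ∀ a : FrameNode p, IsNode S a → a ≠ Sum.inr z := fun a ha haz =>
    hzS (Finset.mem_union_left _ (ha z haz))
  set G'' := (G.erase e₁).erase e₂ with hG''
  have hG''G : ∀ e ∈ G'', e ∈ G := fun e he => Finset.mem_of_mem_erase (Finset.mem_of_mem_erase he)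
  have hold : ∀ (a : FrameNode p), (Sum.inr z, a) ∉ G'' := fun a ha =>
    hzN _ (h.left _ (hG''G _ ha)) rfl
  have ne1 : e₁.1 ≠ e₁.2 := fun hh => h.ne _ he₁ (by rw [hh])
  have ne2 : e₂.1 ≠ e₂.2 := fun hh => h.ne _ he₂ (by rw [hh])
  have hcross : ∀ (a b : FrameNode p) (k l : ℝ), k ≠ 0 →
      barDir x (Sum.inr z, a) = k • barDir x e₁ → barDir x (Sum.inr z, b) = l • barDir x e₂ →
      a ≠ b := by
    rintro a b k l hk ha hb rfl
    apply htr
    have : k * wedge (barDir x e₁) (barDir x e₂) = 0 := by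
      rw [← wedge_smul_left, ← ha, hb, wedge_smul_left, wedge_self, mul_zero]
    exact (mul_eq_zero.1 this).resolve_left hk
  have n13 := hcross _ _ (-θ) _ (by linarith) a1 b1
  have n14 := hcross _ _ (-θ) _ (by linarith) a1 b2
  have n23 := hcross _ _ (1 - θ) _ t1' a2 b1
  have n24 := hcross _ _ (1 - θ) _ t1' a2 b2
  have hnet : ∀ (g : Bar p → ℝ) (v : FrameNode p), netLoad x G g v =
      g e₁ • barLoad x e₁ v + (g e₂ • barLoad x e₂ v + netLoad x G'' g v) := by
    intro g v
    have h2 : e₂ ∈ G.erase e₁ := Finset.mem_erase.2 ⟨hne.symm, he₂⟩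
    rw [← netLoad_insert (Finset.notMem_erase _ _), Finset.insert_erase h2,
      ← netLoad_insert (Finset.notMem_erase _ _), Finset.insert_erase he₁]
  have hnet' : ∀ (g : Bar p → ℝ) (v : FrameNode p), netLoad x (cutBars G e₁ e₂ z) g v =
      (θ * g (Sum.inr z, e₁.1)) • ((if v = e₁.1 then barDir x e₁ else 0) -
        (if v = Sum.inr z then barDir x e₁ else 0)) +
      (((1 - θ) * g (Sum.inr z, e₁.2)) • ((if v = Sum.inr z then barDir x e₁ else 0) -
        (if v = e₁.2 then barDir x e₁ else 0)) +
      ((η * g (Sum.inr z, e₂.1)) • ((if v = e₂.1 then barDir x e₂ else 0) -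
        (if v = Sum.inr z then barDir x e₂ else 0)) +
      (((1 - η) * g (Sum.inr z, e₂.2)) • ((if v = Sum.inr z then barDir x e₂ else 0) -
        (if v = e₂.2 then barDir x e₂ else 0)) + netLoad x G'' g v))) := by
    intro g v
    have m1 : ((Sum.inr z, e₂.2) : Bar p) ∉ G'' := hold _
    have m2 : ((Sum.inr z, e₂.1) : Bar p) ∉ insert ((Sum.inr z, e₂.2) : Bar p) G'' := by
      simp [hold, ne2]
    have m3 : ((Sum.inr z, e₁.2) : Bar p) ∉ insert ((Sum.inr z, e₂.1) : Bar p)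
        (insert ((Sum.inr z, e₂.2) : Bar p) G'') := by
      simp [hold, n23, n24]
    have m4 : ((Sum.inr z, e₁.1) : Bar p) ∉ insert ((Sum.inr z, e₁.2) : Bar p)
        (insert ((Sum.inr z, e₂.1) : Bar p) (insert ((Sum.inr z, e₂.2) : Bar p) G'')) := by
      simp [hold, n13, n14, ne1]
    rw [cutBars, ← hG'', netLoad_insert m4, netLoad_insert m3, netLoad_insert m2,
      netLoad_insert m1, barLoad_half_left a1, barLoad_half_right a2, barLoad_half_left b1,
      barLoad_half_right b2]
    simp only [smul_smul, mul_comm]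
  -- Tensions are per unit length: a half whose direction vector is shortened by a factor needs its
  -- tension divided by that factor.
  let s' : Bar p → ℝ := fun e =>
    if e = (Sum.inr z, e₁.1) then s e₁ / θ else if e = (Sum.inr z, e₁.2) then s e₁ / (1 - θ)
    else if e = (Sum.inr z, e₂.1) then s e₂ / η else if e = (Sum.inr z, e₂.2) then s e₂ / (1 - η)
    else s e
  have v1 : s' (Sum.inr z, e₁.1) = s e₁ / θ := by simp [s']
  have v2 : s' (Sum.inr z, e₁.2) = s e₁ / (1 - θ) := by simp [s', ne1.symm]
  have v3 : s' (Sum.inr z, e₂.1) = s e₂ / η := by simp [s', n13.symm, n23.symm]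
  have v4 : s' (Sum.inr z, e₂.2) = s e₂ / (1 - η) := by simp [s', n14.symm, n24.symm, ne2.symm]
  have v5 : ∀ e ∈ G'', s' e = s e := by
    intro e he
    have : ∀ a, e ≠ (Sum.inr z, a) := fun a ha => hold a (ha ▸ he)
    simp [s', this]
  have htransfer : ∀ (g g' : Bar p → ℝ), g e₁ = θ * g' (Sum.inr z, e₁.1) →
      g e₁ = (1 - θ) * g' (Sum.inr z, e₁.2) → g e₂ = η * g' (Sum.inr z, e₂.1) →
      g e₂ = (1 - η) * g' (Sum.inr z, e₂.2) → (∀ e ∈ G'', g e = g' e) → ∀ v,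
      netLoad x (cutBars G e₁ e₂ z) g' v = netLoad x G g v := by
    intro g g' h1 h2 h3 h4 h5 v
    rw [hnet', hnet, ← h1, ← h2, ← h3, ← h4, netLoad_congr h5]
    simp only [barLoad]
    module
  have hstress := htransfer s s' (by rw [v1]; field_simp) (by rw [v2]; field_simp)
    (by rw [v3]; field_simp) (by rw [v4]; field_simp) (fun e he => (v5 e he).symm)
  have hzero : ∀ g : Bar p → ℝ, netLoad x G'' g (Sum.inr z) = 0 := by
    intro g
    refine Finset.sum_eq_zero fun e he => ?_
    have h1 := hzN _ (h.left _ (hG''G _ he))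
    have h2 := hzN _ (h.right _ (hG''G _ he))
    simp [barLoad, h1.symm, h2.symm]
  have q1 := (hzN _ (h.left _ he₁)).symm
  have q2 := (hzN _ (h.right _ he₁)).symm
  have q3 := (hzN _ (h.left _ he₂)).symm
  have q4 := (hzN _ (h.right _ he₂)).symm
  refine ⟨s', ?_, ?_, ?_⟩
  · intro w hw
    rw [hstress]
    rcases Finset.mem_insert.1 hw with rfl | hw
    · rw [hnet, hzero]
      simp [barLoad, q1, q2, q3, q4]
    · exact hs.internal w hw
  · intro i
    rw [hstress, hs.terminal]
  · intro g' hg'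
    have hgz := hg' z (Finset.mem_insert_self _ _)
    rw [hnet', hzero] at hgz
    simp only [q1, q2, q3, q4, if_false, if_true, zero_sub, sub_zero, add_zero] at hgz
    have hlin : ((1 - θ) * g' (Sum.inr z, e₁.2) - θ * g' (Sum.inr z, e₁.1)) • barDir x e₁ +
        ((1 - η) * g' (Sum.inr z, e₂.2) - η * g' (Sum.inr z, e₂.1)) • barDir x e₂ = 0 := by
      rw [← hgz]; module
    obtain ⟨k1, k2⟩ := eq_zero_of_smul_add_smul htr hlin
    let g : Bar p → ℝ := fun e => if e = e₁ then θ * g' (Sum.inr z, e₁.1) else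
      if e = e₂ then η * g' (Sum.inr z, e₂.1) else g' e
    have w1 : g e₁ = θ * g' (Sum.inr z, e₁.1) := by simp [g]
    have w2 : g e₂ = η * g' (Sum.inr z, e₂.1) := by simp [g, hne.symm]
    have w3 : ∀ e ∈ G'', g e = g' e := by
      intro e he
      have h1 : e ≠ e₂ := Finset.ne_of_mem_erase he
      have h2 : e ≠ e₁ := Finset.ne_of_mem_erase (Finset.mem_of_mem_erase he)
      simp [g, h1, h2]
    have htr' := htransfer g g' w1 (by rw [w1]; linarith) w2 (by rw [w2]; linarith) w3
    obtain ⟨c, hc⟩ := hs.unique g fun w hw => by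
      rw [← htr']; exact hg' w (Finset.mem_insert_of_mem hw)
    have hc1 := hc e₁ he₁
    have hc2 := hc e₂ he₂
    rw [w1] at hc1
    rw [w2] at hc2
    refine ⟨c, fun e he => ?_⟩
    rcases mem_cutBars.1 he with ⟨h1, h2, h3⟩ | (rfl | rfl) | (rfl | rfl)
    · have heG : e ∈ G'' := Finset.mem_erase.2 ⟨h3, Finset.mem_erase.2 ⟨h2, h1⟩⟩
      rw [v5 e heG, ← w3 e heG, hc e h1]
    · rw [v1]; field_simp; linarith
    · rw [v2]; field_simp; linarith
    · rw [v3]; field_simp; linarith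
    · rw [v4]; field_simp; linarith

/-- Every frame of rank one in general position can be made planar by turning the points where
bars cross into nodes. -/
theorem exists_planar {f : Fin p → Plane} {F : Finset Plane} {U : Set Plane} (hU : Convex ℝ U)
    (hxU : ∀ i, x i ∈ U) {S : Finset Plane} {G : Finset (Bar p)} {s : Bar p → ℝ}
    (hG : Generic x F S G) (hs : IsRankOne x f S G s) (hS : ∀ z ∈ S, z ∈ U) :
    ∃ S' G' s', Generic x F S' G' ∧ IsRankOne x f S' G' s' ∧ (∀ z ∈ S', z ∈ U) ∧
      ∀ e ∈ G', ∀ e' ∈ G', e ≠ e' → Disjoint (barSeg x e) (barSeg x e') := by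
  induction hn : (crossings x G).ncard using Nat.strong_induction_on generalizing S G s with
  | _ n ih =>
    by_cases hd : ∀ e ∈ G, ∀ e' ∈ G, e ≠ e' → Disjoint (barSeg x e) (barSeg x e')
    · exact ⟨S, G, s, hG, hs, hS, hd⟩
    push Not at hd
    obtain ⟨e₁, he₁, e₂, he₂, hne, hnd⟩ := hd
    obtain ⟨z, hz₁, hz₂⟩ := Set.not_disjoint_iff.1 hnd
    obtain ⟨hG', hcr⟩ := hG.cut he₁ he₂ hne hz₁ hz₂
    obtain ⟨s', hs'⟩ := hs.cut hG he₁ he₂ hne hz₁ hz₂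
    have hpos : ∀ a : FrameNode p, IsNode S a → nodePos x a ∈ U := by
      rintro (i | w) ha
      · exact hxU i
      · exact hS w (ha w rfl)
    -- The cut removes the crossing `z` and creates none, so the number of crossings drops. The new
    -- node stays in `U` by convexity.
    refine ih _ ?_ hG' hs' ?_ rfl
    · rw [← hn]
      refine Set.ncard_lt_ncard ?_ hG.crossings_finite
      refine (Set.ssubset_iff_of_subset (hcr.trans Set.sdiff_subset)).2
        ⟨z, ⟨e₁, he₁, e₂, he₂, hne, hz₁, hz₂⟩, fun hz => (hcr hz).2 rfl⟩
    · intro w hw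
      rcases Finset.mem_insert.1 hw with rfl | hw
      · exact hU.openSegment_subset (hpos _ (hG.left _ he₁)) (hpos _ (hG.right _ he₁)) hz₁
      · exact hS w hw

/-! ### Adding nodes and bars in general position. -/

variable (x) in
/-- The bar from `z` to the node `b` can be added to a frame in general position. -/
structure BarClear (F S : Finset Plane) (G : Finset (Bar p)) (z : Plane) (b : FrameNode p) :
    Prop where
  avoid : ∀ q ∈ S ∪ F, q ∉ barSeg x (Sum.inr z, b)
  transverse : ∀ e ∈ G, ∀ q ∈ barSeg x (Sum.inr z, b), q ∈ barSeg x e →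
    wedge (barDir x (Sum.inr z, b)) (barDir x e) ≠ 0
  triple : ∀ e ∈ G, ∀ e' ∈ G, e ≠ e' → ∀ q ∈ barSeg x e, q ∈ barSeg x e' →
    q ∉ barSeg x (Sum.inr z, b)

theorem BarClear.of_disjoint {F S : Finset Plane} {G : Finset (Bar p)} {z : Plane}
    {b : FrameNode p} (hS : ∀ q ∈ S ∪ F, q ∉ barSeg x (Sum.inr z, b))
    (hG : ∀ e ∈ G, ∀ q ∈ barSeg x (Sum.inr z, b), q ∉ barSeg x e) : BarClear x F S G z b where
  avoid := hS
  transverse e he q hq hq' := absurd hq' (hG e he q hq)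
  triple e he _ _ _ q hq _ hq'' := hG e he q hq'' hq

/-- All conditions on the bar follow if `z` is off the lines that join `b` to the other nodes, the
points of `F` and the crossings. -/
theorem Generic.barClear {F S : Finset Plane} {G : Finset (Bar p)} (h : Generic x F S G)
    {z : Plane} {b : FrameNode p} (hzb : z ≠ nodePos x b) (hb : IsNode S b)
    (hS : ∀ y ∈ S ∪ F, y ≠ nodePos x b → wedge (z - nodePos x b) (y - nodePos x b) ≠ 0)
    (hX : ∀ y ∈ crossings x G, y ≠ nodePos x b →
      wedge (z - nodePos x b) (y - nodePos x b) ≠ 0) : BarClear x F S G z b where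
  avoid q hq hqz := by
    refine hS q hq ?_ (wedge_right_of_mem_openSegment hqz)
    rintro rfl
    exact hzb (right_mem_openSegment_iff.1 hqz)
  transverse e he q hq hqe h0 := by
    have hq1 : wedge (z - nodePos x b) (q - nodePos x b) = 0 := wedge_right_of_mem_openSegment hq
    obtain ⟨θ, -, -, hθ⟩ := mem_openSegment_iff.1 hqe
    have hdir : wedge (z - nodePos x b) (barDir x e) = 0 := by
      have : barDir x (Sum.inr z, b) = -(z - nodePos x b) := by simp [barDir]
      rw [this, wedge_neg_left, neg_eq_zero] at h0
      exact h0
    -- If the bars were parallel at a common point, the whole line of `e` would be the line from `z`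
    -- to `b`. At least one end of `e` differs from `b` in position, and that end would lie on a
    -- line avoided by `z`.
    have key : ∀ k : ℝ, wedge (z - nodePos x b) (q + k • barDir x e - nodePos x b) = 0 := by
      intro k
      rw [add_sub_right_comm, wedge_add_right, wedge_smul_right, hdir, hq1]; simp
    by_cases h1 : nodePos x e.1 = nodePos x b
    · refine hS _ (h.nodePos_mem (h.right e he)) (fun h2 => h.ne e he (h1.trans h2.symm)) ?_
      rw [← key (1 - θ), hθ]
      congr 2
      rw [barDir]; module
    · refine hS _ (h.nodePos_mem (h.left e he)) h1 ?_
      rw [← key (-θ), hθ]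
      congr 2
      rw [barDir]; module
  triple e he e' he' hne q hq hq' hqz := by
    refine hX q ⟨e, he, e', he', hne, hq, hq'⟩ ?_ (wedge_right_of_mem_openSegment hqz)
    rintro rfl
    exact h.avoid e he _ (h.nodePos_mem hb) hq

theorem disjoint_barSeg_of_wedge {z : Plane} {b b' : FrameNode p}
    (h : wedge (nodePos x b - z) (nodePos x b' - z) ≠ 0) :
    Disjoint (barSeg x (Sum.inr z, b)) (barSeg x (Sum.inr z, b')) := by
  refine Set.disjoint_left.2 fun q hq hq' => ?_
  obtain ⟨θ, t0, -, ht⟩ := mem_openSegment_iff.1 hq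
  obtain ⟨η, u0, -, hu⟩ := mem_openSegment_iff.1 hq'
  simp only [nodePos_inr] at ht hu
  have : θ • (nodePos x b - z) + (-η) • (nodePos x b' - z) = 0 := by
    rw [neg_smul, ← sub_eq_add_neg, sub_eq_zero]
    exact add_left_cancel (ht.symm.trans hu)
  exact t0.ne' (eq_zero_of_smul_add_smul h this).1

/-- A new node `z` joined to the nodes in `B`. -/
theorem Generic.insert {F S : Finset Plane} {G : Finset (Bar p)} (h : Generic x F S G)
    {z : Plane} (hz : z ∉ S ∪ F) (hzG : ∀ e ∈ G, z ∉ barSeg x e) {B : Finset (FrameNode p)}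
    (hB : ∀ b ∈ B, IsNode S b) (hclear : ∀ b ∈ B, BarClear x F S G z b)
    (hdisj : ∀ b ∈ B, ∀ b' ∈ B, b ≠ b' →
      Disjoint (barSeg x (Sum.inr z, b)) (barSeg x (Sum.inr z, b'))) :
    Generic x F (insert z S) (B.image (fun b => ((Sum.inr z, b) : Bar p)) ∪ G) := by
  have hmem : ∀ {e : Bar p}, e ∈ B.image (fun b => ((Sum.inr z, b) : Bar p)) ∪ G →
      (∃ b ∈ B, e = (Sum.inr z, b)) ∨ e ∈ G := by
    intro e he
    rcases Finset.mem_union.1 he with he | he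
    · obtain ⟨b, hb, rfl⟩ := Finset.mem_image.1 he
      exact Or.inl ⟨b, hb, rfl⟩
    · exact Or.inr he
  have hzb : ∀ b ∈ B, z ≠ nodePos x b := fun b hb hzb =>
    hz (hzb ▸ h.nodePos_mem (hB b hb))
  refine ⟨h.terminal_mem, ?_, ?_, ?_, ?_, ?_, ?_, ?_⟩
  · intro w hw
    rcases Finset.mem_insert.1 hw with rfl | hw
    · exact fun hF => hz (Finset.mem_union_right _ hF)
    · exact h.notMem w hw
  · intro e he
    rcases hmem he with ⟨b, hb, rfl⟩ | he
    · exact isNode_inr (Finset.mem_insert_self _ _)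
    · exact (h.left e he).mono (Finset.subset_insert _ _)
  · intro e he
    rcases hmem he with ⟨b, hb, rfl⟩ | he
    · exact (hB b hb).mono (Finset.subset_insert _ _)
    · exact (h.right e he).mono (Finset.subset_insert _ _)
  · intro e he
    rcases hmem he with ⟨b, hb, rfl⟩ | he
    · exact hzb b hb
    · exact h.ne e he
  · intro e he q hq
    rw [Finset.insert_union] at hq
    rcases hmem he with ⟨b, hb, rfl⟩ | he
    · rcases Finset.mem_insert.1 hq with rfl | hq
      · exact fun hq => hzb b hb (left_mem_openSegment_iff.1 hq)
      · exact (hclear b hb).avoid q hq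
    · rcases Finset.mem_insert.1 hq with hqz | hq
      · exact hqz ▸ hzG e he
      · exact h.avoid e he q hq
  · intro e he e' he' hne q hq hq'
    rcases hmem he with ⟨b, hb, rfl⟩ | he <;> rcases hmem he' with ⟨b', hb', rfl⟩ | he'
    · exact absurd hq' (Set.disjoint_left.1 (hdisj b hb b' hb' fun hbb => hne (by rw [hbb])) hq)
    · exact (hclear b hb).transverse e' he' q hq hq'
    · rw [wedge_comm_neg, neg_ne_zero]
      exact (hclear b' hb').transverse e he q hq' hq
    · exact h.transverse e he e' he' hne q hq hq'
  · have hd : ∀ b ∈ B, ∀ b' ∈ B, ((Sum.inr z, b) : Bar p) ≠ (Sum.inr z, b') → ∀ q,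
        q ∈ barSeg x (Sum.inr z, b) → q ∉ barSeg x (Sum.inr z, b') :=
      fun b hb b' hb' hne q hq =>
        Set.disjoint_left.1 (hdisj b hb b' hb' fun hbb => hne (by rw [hbb])) hq
    intro e he e' he' e'' he'' n1 n2 n3 q hq hq' hq''
    rcases hmem he with ⟨b, hb, rfl⟩ | he <;> rcases hmem he' with ⟨b', hb', rfl⟩ | he' <;>
    rcases hmem he'' with ⟨b'', hb'', rfl⟩ | he''
    · exact hd b hb b' hb' n1 q hq hq'
    · exact hd b hb b' hb' n1 q hq hq'
    · exact hd b hb b'' hb'' n2 q hq hq''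
    · exact (hclear b hb).triple e' he' e'' he'' n3 q hq' hq'' hq
    · exact hd b' hb' b'' hb'' n3 q hq' hq''
    · exact (hclear b' hb').triple e he e'' he'' n2 q hq hq'' hq'
    · exact (hclear b'' hb'').triple e he e' he' n1 q hq hq' hq''
    · exact h.triple e he e' he' e'' he'' n1 n2 n3 q hq hq' hq''

/-- A node in general position can be found in every open set, and can be joined to any node. -/
theorem Generic.exists_node {F S : Finset Plane} {G : Finset (Bar p)} (h : Generic x F S G)
    {U : Set Plane} (hU : IsOpen U) {x₀ : Plane} (hx₀ : x₀ ∈ U) (l : Plane × Plane) :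
    ∃ z ∈ U, z ∉ S ∪ F ∧ (∀ y ∈ S ∪ F, ∀ y' ∈ S ∪ F, y ≠ y' → wedge (z - y) (y' - y) ≠ 0) ∧
      (l.2 ≠ 0 → wedge (z - l.1) l.2 ≠ 0) ∧
      ∀ b : FrameNode p, IsNode S b →
        Generic x F (Insert.insert z S) (Insert.insert (Sum.inr z, b) G) := by
  let A : Set Plane := ↑(S ∪ F) ∪ crossings x G
  have hA : A.Finite := (Finset.finite_toSet _).union h.crossings_finite
  -- An arbitrary nonzero direction: avoiding the lines in this direction through the points of `A`
  -- ensures `z ∉ A`.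
  let c : Plane := EuclideanSpace.single 0 1
  have hc : c ≠ 0 := by
    intro h0
    have := congrArg (fun v : Plane => v 0) h0
    simp [c] at this
  obtain ⟨z, hzU, hz⟩ := exists_mem_forall_wedge_ne_zero hU hx₀
    (L := (fun yy : Plane × Plane => (yy.1, yy.2 - yy.1)) '' (A ×ˢ A) ∪
      ((fun y : Plane => (y, c)) '' A ∪ {l}))
    (((hA.prod hA).image _).union ((hA.image _).union (Set.finite_singleton _)))
  have hzA : ∀ y ∈ A, ∀ y' ∈ A, y ≠ y' → wedge (z - y) (y' - y) ≠ 0 := fun y hy y' hy' hne =>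
    hz (y, y' - y) (Or.inl ⟨(y, y'), ⟨hy, hy'⟩, rfl⟩) (sub_ne_zero.2 hne.symm)
  have hzA' : z ∉ A := fun hzA => by
    have : wedge (z - z) c ≠ 0 := hz (z, c) (Or.inr (Or.inl ⟨z, hzA, rfl⟩)) hc
    rw [sub_self, wedge_zero_left] at this
    exact this rfl
  have hSA : ∀ y ∈ S ∪ F, y ∈ A := fun y hy => Or.inl hy
  have hzS : z ∉ S ∪ F := fun hz => hzA' (hSA z hz)
  refine ⟨z, hzU, hzS, fun y hy y' hy' => hzA y (hSA y hy) y' (hSA y' hy'),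
    hz l (Or.inr (Or.inr rfl)), fun b hb => ?_⟩
  have hbA := h.nodePos_mem hb
  have := h.insert (B := {b}) hzS (fun e he hze => ?_) (by simpa using hb) ?_ ?_
  · rwa [Finset.image_singleton, ← Finset.insert_eq] at this
  · exact hzA _ (hSA _ (h.nodePos_mem (h.left e he))) _ (hSA _ (h.nodePos_mem (h.right e he)))
      (h.ne e he) (wedge_of_mem_openSegment hze)
  · intro b' hb'
    rw [Finset.mem_singleton.1 hb']
    exact h.barClear (fun hzb => hzS (hzb ▸ hbA)) hb
      (fun y hy hyb => hzA _ (hSA _ hbA) y (hSA _ hy) hyb.symm)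
      (fun y hy hyb => hzA _ (hSA _ hbA) y (Or.inr hy) hyb.symm)
  · intro b' hb' b'' hb'' hne
    rw [Finset.mem_singleton.1 hb', Finset.mem_singleton.1 hb''] at hne
    exact absurd rfl hne

/-- A node `z` near the node `v`, on the ray in the direction `g`, is joined to `v` by a short bar,
and to two more nodes `v'` and `o`. -/
theorem Generic.exists_ray_node {F S : Finset Plane} {G : Finset (Bar p)} (h : Generic x F S G)
    {U : Set Plane} (hU : IsOpen U) {v v' o g : Plane} (hvU : v ∈ U) (hv : v ∈ S) (hv' : v' ∈ S)
    (ho : o ∈ S) (hvv' : v' ≠ v) (hvo : o ≠ v) (hv'o : v' ≠ o)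
    (haim : ∀ d ∈ S ∪ F, d ≠ v → wedge g (d - v) ≠ 0) {L : Set Plane} (hL : L.Finite) :
    ∃ t : ℝ, 0 < t ∧ v + t • g ∈ U ∧ v + t • g ∉ S ∪ F ∧
      (∀ y ∈ S ∪ F, y ≠ v' → wedge (v + t • g - v') (y - v') ≠ 0) ∧
      (∀ V ∈ L, V ≠ 0 → wedge (v + t • g - v') V ≠ 0) ∧
      Generic x F (Insert.insert (v + t • g) S)
        (Insert.insert (Sum.inr (v + t • g), Sum.inr v)
          (Insert.insert (Sum.inr (v + t • g), Sum.inr v')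
            (Insert.insert (Sum.inr (v + t • g), Sum.inr o) G))) := by
  have hSF : ∀ {q}, q ∈ S → q ∈ S ∪ F := fun hq => Finset.mem_union_left _ hq
  have hgv' : wedge g (v' - v) ≠ 0 := haim v' (hSF hv') hvv'
  have hgo : wedge g (o - v) ≠ 0 := haim o (hSF ho) hvo
  have hg : g ≠ 0 := fun h0 => hgo (by rw [h0, wedge_zero_left])
  have hfar : ∀ t : ℝ, 0 < t → v + t • g ∉ S ∪ F := by
    intro t ht hmem
    have hne : v + t • g ≠ v := by
      rw [Ne, add_eq_left, smul_eq_zero, not_or]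
      exact ⟨ht.ne', hg⟩
    apply haim _ hmem hne
    rw [add_sub_cancel_left, wedge_smul_right, wedge_self, mul_zero]
  have hA : (↑(S ∪ F) ∪ crossings x G : Set Plane).Finite :=
    (Finset.finite_toSet _).union h.crossings_finite
  have hcont : Filter.Tendsto (fun t : ℝ => v + t • g) (nhdsWithin 0 (Set.Ioi 0)) (nhds v) := by
    have : Continuous fun t : ℝ => v + t • g := by fun_prop
    have h0 := this.tendsto 0
    simp only [zero_smul, add_zero] at h0
    exact h0.mono_left nhdsWithin_le_nhds
  have hEU : ∀ᶠ t in nhdsWithin (0 : ℝ) (Set.Ioi 0), v + t • g ∈ U :=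
    hcont.eventually (hU.mem_nhds hvU)
  have hEp : ∀ b : Plane, wedge g (b - v) ≠ 0 → ∀ᶠ t in nhdsWithin (0 : ℝ) (Set.Ioi 0),
      ∀ y ∈ (↑(S ∪ F) ∪ crossings x G : Set Plane), y ≠ b →
        wedge (v + t • g - b) (y - b) ≠ 0 := by
    intro b hb
    refine (Filter.eventually_all_finite hA).2 fun y _ => ?_
    by_cases hyb : y = b
    · exact Filter.Eventually.of_forall fun t h => absurd hyb h
    · filter_upwards [eventually_ray_wedge_ne_zero hb (sub_ne_zero.2 hyb)] with t ht _ using ht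
  have hEL : ∀ᶠ t in nhdsWithin (0 : ℝ) (Set.Ioi 0),
      ∀ V ∈ L, V ≠ 0 → wedge (v + t • g - v') V ≠ 0 := by
    refine (Filter.eventually_all_finite hL).2 fun V _ => ?_
    by_cases hV : V = 0
    · exact Filter.Eventually.of_forall fun t h => absurd hV h
    · filter_upwards [eventually_ray_wedge_ne_zero hgv' hV] with t ht _ using ht
  have hEG : ∀ᶠ t in nhdsWithin (0 : ℝ) (Set.Ioi 0), ∀ e ∈ G, v + t • g ∉ barSeg x e := by
    refine (Filter.eventually_all_finset G).2 fun e he => ?_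
    -- Otherwise `e` would lie on the line of the ray. Since `g` aims at no node other than `v`,
    -- both ends of `e` would be at `v`.
    have hne : wedge (v - nodePos x e.1) (barDir x e) ≠ 0 ∨ wedge g (barDir x e) ≠ 0 := by
      by_contra hcon
      push Not at hcon
      have hd : barDir x e ≠ 0 := sub_ne_zero.2 (h.ne e he).symm
      obtain ⟨a, ha⟩ := exists_eq_smul_of_wedge_eq_zero hd hcon.1
      have h1 : wedge g (nodePos x e.1 - v) = 0 := by
        rw [← neg_sub, ha, wedge_neg_right, wedge_smul_right, hcon.2]; simp
      have h2 : wedge g (nodePos x e.2 - v) = 0 := by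
        have : nodePos x e.2 - v = (nodePos x e.1 - v) + barDir x e := by rw [barDir]; abel
        rw [this, wedge_add_right, h1, hcon.2, add_zero]
      have h3 : nodePos x e.1 = v := by
        by_contra hcon'
        exact haim _ (h.nodePos_mem (h.left e he)) hcon' h1
      have h4 : nodePos x e.2 = v := by
        by_contra hcon'
        exact haim _ (h.nodePos_mem (h.right e he)) hcon' h2
      exact h.ne e he (h3.trans h4.symm)
    filter_upwards [eventually_affine_ne_zero hne] with t ht hmem
    apply ht
    have := wedge_of_mem_openSegment hmem
    rwa [add_sub_right_comm, wedge_add_left, wedge_smul_left] at this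
  -- A whole interval of parameters is needed, because every point of the short bar from `z` to `v`,
  -- not just `z`, has to miss the bars of `G`.
  obtain ⟨δ, hδ, hδG⟩ := mem_nhdsGT_iff_exists_Ioo_subset.1 hEG
  have hEδ : ∀ᶠ t in nhdsWithin (0 : ℝ) (Set.Ioi 0), t ∈ Set.Ioo 0 δ :=
    Ioo_mem_nhdsGT hδ
  obtain ⟨t, ⟨⟨⟨⟨htU, htv'⟩, hto⟩, htL⟩, ht0, htδ⟩⟩ :=
    ((((hEU.and (hEp v' hgv')).and (hEp o hgo)).and hEL).and hEδ).exists
  set z := v + t • g with hz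
  have hzS : z ∉ S ∪ F := hfar t ht0
  have hzG : ∀ e ∈ G, z ∉ barSeg x e := hδG ⟨ht0, htδ⟩
  have hshort : ∀ q ∈ barSeg x (Sum.inr z, Sum.inr v), ∃ τ, 0 < τ ∧ τ < δ ∧ q = v + τ • g := by
    intro q hq
    obtain ⟨θ, h0, h1, hθ⟩ := mem_openSegment_iff.1 hq
    refine ⟨(1 - θ) * t, mul_pos (by linarith) ht0, ?_, ?_⟩
    · nlinarith
    · rw [hθ, nodePos_inr, nodePos_inr, hz]; module
  have hclear1 : BarClear x F S G z (Sum.inr v) := by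
    refine BarClear.of_disjoint ?_ ?_
    · intro q hq hqv
      obtain ⟨τ, h0, -, rfl⟩ := hshort q hqv
      exact hfar τ h0 hq
    · intro e he q hq
      obtain ⟨τ, h0, h1, rfl⟩ := hshort q hq
      exact hδG ⟨h0, h1⟩ e he
  have hclear2 : ∀ b ∈ S, (∀ y ∈ (↑(S ∪ F) ∪ crossings x G : Set Plane), y ≠ b →
      wedge (z - b) (y - b) ≠ 0) → BarClear x F S G z (Sum.inr b) := by
    intro b hb hy
    exact h.barClear (fun hzb => hzS (by rw [hzb]; exact hSF hb)) (isNode_inr hb)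
      (fun y hyS => hy y (Or.inl hyS)) (fun y hyS => hy y (Or.inr hyS))
  have hdir : ∀ b, wedge g (b - v) ≠ 0 → wedge (v - z) (b - z) ≠ 0 := by
    intro b hb
    have : wedge (v - z) (b - z) = -(t * wedge g (b - v)) := by
      rw [hz]; simp [wedge]; ring
    rw [this]
    exact neg_ne_zero.2 (mul_ne_zero ht0.ne' hb)
  have hdir' : wedge (v' - z) (o - z) ≠ 0 := by
    have h1 := htv' o (Or.inl (hSF ho)) hv'o.symm
    have : wedge (v' - z) (o - z) = -wedge (z - v') (o - v') := by simp [wedge]; ring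
    rw [this]
    exact neg_ne_zero.2 h1
  refine ⟨t, ht0, htU, hzS, fun y hy => htv' y (Or.inl hy), htL, ?_⟩
  have := h.insert (B := {Sum.inr v, Sum.inr v', Sum.inr o}) hzS hzG ?_ ?_ ?_
  · simpa [Finset.image_insert] using this
  · intro b hb
    simp only [Finset.mem_insert, Finset.mem_singleton] at hb
    rcases hb with rfl | rfl | rfl
    · exact isNode_inr hv
    · exact isNode_inr hv'
    · exact isNode_inr ho
  · intro b hb
    simp only [Finset.mem_insert, Finset.mem_singleton] at hb
    rcases hb with rfl | rfl | rfl
    · exact hclear1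
    · exact hclear2 v' hv' htv'
    · exact hclear2 o ho hto
  · have d1 := disjoint_barSeg_of_wedge (x := x) (b := Sum.inr v) (b' := Sum.inr v')
      (hdir v' hgv')
    have d2 := disjoint_barSeg_of_wedge (x := x) (b := Sum.inr v) (b' := Sum.inr o) (hdir o hgo)
    have d3 := disjoint_barSeg_of_wedge (x := x) (b := Sum.inr v') (b' := Sum.inr o) hdir'
    intro b hb b' hb' hne
    simp only [Finset.mem_insert, Finset.mem_singleton] at hb hb'
    rcases hb with rfl | rfl | rfl <;> rcases hb' with rfl | rfl | rfl
    exacts [absurd rfl hne, d1, d2, d1.symm, absurd rfl hne, d3, d2.symm, d3.symm,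
      absurd rfl hne]

/-! ### Carrying the forces along a chain of hangers. -/

/-- A bar under tension from the node `node` to a terminal. -/
structure Hanger (p : ℕ) where
  /-- The terminal. -/
  terminal : Fin p
  /-- The internal node. -/
  node : Plane
  /-- The tension per unit length. -/
  tension : ℝ

/-- The bar of a hanger. -/
def Hanger.bar (ρ : Hanger p) : Bar p := (Sum.inr ρ.node, Sum.inl ρ.terminal)

variable (x) in
/-- The total force exerted by hangers on a terminal. -/
noncomputable def hangerForce (R : List (Hanger p)) (i : Fin p) : Plane :=
  (R.map fun ρ => if i = ρ.terminal then ρ.tension • (ρ.node - x i) else 0).sum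

theorem hangerForce_cons (ρ : Hanger p) (R : List (Hanger p)) (i : Fin p) :
    hangerForce x (ρ :: R) i =
      (if i = ρ.terminal then ρ.tension • (ρ.node - x i) else 0) + hangerForce x R i := by
  simp [hangerForce]

variable (x) in
/-- A stress `s` on the bars `E ⊆ G`, determined up to a factor by the equilibrium of the nodes
other than `o`, `y` and `v`, that together with the hangers in `R` (which are bars of `G`, not of
`E`) exerts the forces `f` on the terminals. -/
structure Carry (f : Fin p → Plane) (F : Finset Plane) (U : Set Plane) (o y v : Plane)
    (R : List (Hanger p)) (S : Finset Plane) (G E : Finset (Bar p)) (s : Bar p → ℝ) : Prop where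
  generic : Generic x F S G
  mem : ∀ q ∈ S, q ∈ U
  sub : E ⊆ G
  o_mem : o ∈ S
  y_mem : y ∈ S
  v_mem : v ∈ S
  o_ne_y : o ≠ y
  internal : ∀ q ∈ S, q ≠ o → q ≠ y → q ≠ v → netLoad x E s (Sum.inr q) = 0
  terminal : ∀ i, netLoad x E s (Sum.inl i) + hangerForce x R i = f i
  unique : ∀ s' : Bar p → ℝ,
    (∀ q ∈ S, q ≠ o → q ≠ y → q ≠ v → netLoad x E s' (Sum.inr q) = 0) →
    ∃ c : ℝ, ∀ e ∈ E, s' e = c * s e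
  node_mem : ∀ ρ ∈ R, ρ.node ∈ S
  node_ne_o : ∀ ρ ∈ R, ρ.node ≠ o
  node_ne_y : ∀ ρ ∈ R, ρ.node ≠ y
  tension_ne : ∀ ρ ∈ R, ρ.tension ≠ 0
  bar_mem : ∀ ρ ∈ R, ρ.bar ∈ G
  bar_notMem : ∀ ρ ∈ R, ρ.bar ∉ E
  nodup : (R.map Hanger.node).Nodup
  untouched : ∀ ρ ∈ R, ρ.node ≠ v →
    ∀ e ∈ E, e.1 ≠ Sum.inr ρ.node ∧ e.2 ≠ Sum.inr ρ.node
  closing_mem : (Sum.inr o, Sum.inr y) ∈ G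
  closing_notMem : (Sum.inr o, Sum.inr y) ∉ E

theorem barLoad_of_ne {e : Bar p} {a : FrameNode p} (h1 : a ≠ e.1) (h2 : a ≠ e.2) :
    barLoad x e a = 0 := by
  simp [barLoad, h1, h2]

theorem netLoad_eq_zero_of_untouched {E : Finset (Bar p)} {a : FrameNode p}
    (h : ∀ e ∈ E, e.1 ≠ a ∧ e.2 ≠ a) (s : Bar p → ℝ) : netLoad x E s a = 0 :=
  Finset.sum_eq_zero fun e he => by
    rw [barLoad_of_ne (h e he).1.symm (h e he).2.symm, smul_zero]

/-- The force carried to the node of the hanger `ρ` is passed on, together with the force of `ρ`,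
to the node `v'`, with the help of the support `o`. -/
theorem Carry.step {f : Fin p → Plane} {F : Finset Plane} {U : Set Plane} (hU : IsOpen U)
    {o y : Plane} {ρ : Hanger p} {R : List (Hanger p)} {S : Finset Plane} {G E : Finset (Bar p)}
    {s : Bar p → ℝ} (h : Carry x f F U o y ρ.node (ρ :: R) S G E s) {g : Plane}
    (hg : g = netLoad x E s (Sum.inr ρ.node) + ρ.tension • (x ρ.terminal - ρ.node))
    (haim : ∀ d ∈ S ∪ F, d ≠ ρ.node → wedge g (d - ρ.node) ≠ 0)
    {v' : Plane} (hv' : v' ∈ S) (hv'o : v' ≠ o) (hv'v : v' ≠ ρ.node)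
    (hun : v' = y ∨ ∀ e ∈ E, e.1 ≠ Sum.inr v' ∧ e.2 ≠ Sum.inr v')
    {L : Set Plane} (hL : L.Finite) :
    ∃ (z : Plane) (G' E' : Finset (Bar p)) (s' : Bar p → ℝ) (k : ℝ),
      Carry x f F U o y v' R (insert z S) G' E' s' ∧
      netLoad x E' s' (Sum.inr v') = netLoad x E s (Sum.inr v') + k • (v' - z) ∧
      k * wedge (v' - z) (v' - o) = wedge g (ρ.node - o) ∧
      (∀ d ∈ S ∪ F, d ≠ v' → wedge (z - v') (d - v') ≠ 0) ∧
      ∀ V ∈ L, V ≠ 0 → wedge (z - v') V ≠ 0 := by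
  have hρR : ρ ∈ ρ :: R := List.mem_cons_self
  have hρo := h.node_ne_o ρ hρR
  have hρy := h.node_ne_y ρ hρR
  have hxF : ∀ i, x i ∈ S ∪ F := fun i => Finset.mem_union_right _ (h.generic.terminal_mem i)
  obtain ⟨t, ht, hzU, hzS, hzd, hzL, hgen⟩ := h.generic.exists_ray_node hU (h.mem _ h.v_mem)
    h.v_mem hv' h.o_mem hv'v hρo.symm hv'o haim hL
  set v := ρ.node with hv
  set u := ρ.terminal with hu
  set z := v + t • g with hz
  have hzq : ∀ q ∈ S, q ≠ z := fun q hq hqz => hzS (hqz ▸ Finset.mem_union_left _ hq)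
  have hzv : v ≠ z := hzq v h.v_mem
  have hzv' : v' ≠ z := hzq v' hv'
  have hzo : o ≠ z := hzq o h.o_mem
  have hzy : y ≠ z := hzq y h.y_mem
  have hxv : x u ≠ v := fun hx =>
    h.generic.notMem v h.v_mem (hx ▸ h.generic.terminal_mem u)
  have hzE : ∀ a : FrameNode p, ((Sum.inr z, a) : Bar p) ∉ E := fun a ha =>
    hzS (Finset.mem_union_left _ (h.generic.left _ (h.sub ha) z rfl))
  have huE : ((Sum.inr v, Sum.inl u) : Bar p) ∉ E := h.bar_notMem ρ hρR
  set E' : Finset (Bar p) := insert (Sum.inr z, Sum.inr v) (insert (Sum.inr z, Sum.inr v')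
    (insert (Sum.inr z, Sum.inr o) (insert (Sum.inr v, Sum.inl u) E))) with hE'
  have hnet : ∀ (g' : Bar p → ℝ) (a : FrameNode p), netLoad x E' g' a =
      g' (Sum.inr z, Sum.inr v) • barLoad x (Sum.inr z, Sum.inr v) a +
      (g' (Sum.inr z, Sum.inr v') • barLoad x (Sum.inr z, Sum.inr v') a +
      (g' (Sum.inr z, Sum.inr o) • barLoad x (Sum.inr z, Sum.inr o) a +
      (g' (Sum.inr v, Sum.inl u) • barLoad x (Sum.inr v, Sum.inl u) a + netLoad x E g' a))) := by
    intro g' a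
    rw [hE', netLoad_insert, netLoad_insert, netLoad_insert, netLoad_insert huE]
    · simp [hzE, hzv.symm]
    · simp [hzE, hv'o, hzv.symm]
    · simp [hzE, hv'v.symm, hρo, hzv.symm]
  have hnetv : ∀ g' : Bar p → ℝ, netLoad x E' g' (Sum.inr v) =
      g' (Sum.inr z, Sum.inr v) • (z - v) + (g' (Sum.inr v, Sum.inl u) • (x u - v) +
        netLoad x E g' (Sum.inr v)) := by
    intro g'
    rw [hnet]
    simp [barLoad, barDir, hzv, hv'v.symm, hρo]
  have hnetv' : ∀ g' : Bar p → ℝ, netLoad x E' g' (Sum.inr v') =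
      g' (Sum.inr z, Sum.inr v') • (z - v') + netLoad x E g' (Sum.inr v') := by
    intro g'
    rw [hnet]
    simp [barLoad, barDir, hzv', hv'v, hv'o]
  have hnetz : ∀ g' : Bar p → ℝ, netLoad x E' g' (Sum.inr z) =
      g' (Sum.inr z, Sum.inr v) • (v - z) + (g' (Sum.inr z, Sum.inr v') • (v' - z) +
        g' (Sum.inr z, Sum.inr o) • (o - z)) := by
    intro g'
    have h0 : netLoad x E g' (Sum.inr z) = 0 := by
      refine netLoad_eq_zero_of_untouched (fun e he => ⟨?_, ?_⟩) g'
      · exact fun hc => hzS (Finset.mem_union_left _ (h.generic.left _ (h.sub he) z hc))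
      · exact fun hc => hzS (Finset.mem_union_left _ (h.generic.right _ (h.sub he) z hc))
    rw [hnet, h0]
    simp [barLoad, barDir, hzv.symm, hzv'.symm, hzo.symm]
  have hnetq : ∀ (g' : Bar p → ℝ) (q : Plane), q ≠ z → q ≠ v → q ≠ v' → q ≠ o →
      netLoad x E' g' (Sum.inr q) = netLoad x E g' (Sum.inr q) := by
    intro g' q h1 h2 h3 h4
    rw [hnet]
    simp [barLoad, h1, h2, h3, h4]
  have hneti : ∀ (g' : Bar p → ℝ) (i : Fin p), netLoad x E' g' (Sum.inl i) =
      (if i = u then g' (Sum.inr v, Sum.inl u) • (v - x i) else 0) +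
        netLoad x E g' (Sum.inl i) := by
    intro g' i
    rw [hnet]
    by_cases hiu : i = u
    · subst hiu; simp [barLoad, barDir]
    · simp [barLoad, hiu]
  have hW : wedge (v' - z) (o - z) ≠ 0 := by
    have h1 := hzd o (Finset.mem_union_left _ h.o_mem) hv'o.symm
    have : wedge (v' - z) (o - z) = -wedge (z - v') (o - v') := by simp [wedge]; ring
    rw [this]
    exact neg_ne_zero.2 h1
  -- At `z` the force `g` is resolved along the bars to `v'` and `o`.
  obtain ⟨γ, β, hγβ⟩ : ∃ γ β : ℝ, -g = γ • (v' - z) + β • (o - z) :=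
    ⟨_, _, exists_eq_smul_add_smul hW (-g)⟩
  -- Since `z - v = t • g`, the tension `-t⁻¹` makes the short bar exert exactly `-g` on `v` and `g`
  -- on `z`.
  let s' : Bar p → ℝ := fun e => if e = (Sum.inr z, Sum.inr v) then -t⁻¹ else
    if e = (Sum.inr z, Sum.inr v') then γ else if e = (Sum.inr z, Sum.inr o) then β else
    if e = (Sum.inr v, Sum.inl u) then ρ.tension else s e
  have k1 : s' (Sum.inr z, Sum.inr v) = -t⁻¹ := by simp [s']
  have k2 : s' (Sum.inr z, Sum.inr v') = γ := by simp [s', hv'v]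
  have k3 : s' (Sum.inr z, Sum.inr o) = β := by simp [s', hv'o.symm, hρo.symm]
  have k4 : s' (Sum.inr v, Sum.inl u) = ρ.tension := by simp [s']
  have k5 : ∀ e ∈ E, s' e = s e := by
    intro e he
    have h1 : ∀ a : FrameNode p, e ≠ (Sum.inr z, a) := fun a ha => hzE a (ha ▸ he)
    have h2 : e ≠ (Sum.inr v, Sum.inl u) := fun ha => huE (ha ▸ he)
    simp [s', h1, h2]
  have k6 : ∀ a, netLoad x E s' a = netLoad x E s a := netLoad_congr k5
  have hzv_eq : z - v = t • g := by rw [hz]; abel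
  have hvz_eq : v - z = (-t) • g := by rw [hz]; module
  have hmemE' : ∀ e, e ∈ E' ↔ e = (Sum.inr z, Sum.inr v) ∨ e = (Sum.inr z, Sum.inr v') ∨
      e = (Sum.inr z, Sum.inr o) ∨ e = (Sum.inr v, Sum.inl u) ∨ e ∈ E := by
    intro e; simp only [hE', Finset.mem_insert]
  have hnodup : ∀ σ ∈ R, σ.node ≠ v := by
    intro σ hσ hcon
    have := h.nodup
    rw [List.map_cons, List.nodup_cons] at this
    exact this.1 (List.mem_map.2 ⟨σ, hσ, hcon⟩)
  refine ⟨z, _, E', s', -γ, ⟨hgen, ?_, ?_, Finset.mem_insert_of_mem h.o_mem,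
    Finset.mem_insert_of_mem h.y_mem, Finset.mem_insert_of_mem hv', h.o_ne_y, ?_, ?_, ?_,
    fun σ hσ => Finset.mem_insert_of_mem (h.node_mem σ (List.mem_cons_of_mem _ hσ)),
    fun σ hσ => h.node_ne_o σ (List.mem_cons_of_mem _ hσ),
    fun σ hσ => h.node_ne_y σ (List.mem_cons_of_mem _ hσ),
    fun σ hσ => h.tension_ne σ (List.mem_cons_of_mem _ hσ), ?_, ?_, ?_, ?_, ?_, ?_⟩, ?_, ?_,
    hzd, hzL⟩
  · intro q hq
    rcases Finset.mem_insert.1 hq with hqz | hq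
    · rw [hqz]; exact hzU
    · exact h.mem q hq
  · intro e he
    have hbar : ((Sum.inr v, Sum.inl u) : Bar p) ∈ G := h.bar_mem ρ hρR
    simp only [Finset.mem_insert]
    rcases (hmemE' e).1 he with he | he | he | he | he
    · exact Or.inl he
    · exact Or.inr (Or.inl he)
    · exact Or.inr (Or.inr (Or.inl he))
    · exact Or.inr (Or.inr (Or.inr (he ▸ hbar)))
    · exact Or.inr (Or.inr (Or.inr (h.sub he)))
  · intro q hq hqo hqy hqv'
    rcases Finset.mem_insert.1 hq with rfl | hq
    · rw [hnetz, k1, k2, k3, ← hγβ, hvz_eq, smul_smul]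
      have : -t⁻¹ * -t = 1 := by field_simp
      rw [this, one_smul, add_neg_cancel]
    · by_cases hqv : q = v
      · rw [hqv, hnetv, k1, k4, k6, add_comm (ρ.tension • _), ← hg, hzv_eq, smul_smul]
        have : -t⁻¹ * t = -1 := by field_simp
        rw [this, neg_one_smul, neg_add_cancel]
      · rw [hnetq _ q (hzq q hq) hqv hqv' hqo, k6]
        exact h.internal q hq hqo hqy hqv
  · intro i
    rw [hneti, k4, k6, ← h.terminal i, hangerForce_cons]
    abel
  · intro g' hg'
    -- The old chain needs equilibrium at `v'` too, which is no longer assumed; it is automatic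
    -- because either `v'` is `y`, or no bar of `E` ends there.
    obtain ⟨c, hc⟩ := h.unique g' fun q hq hqo hqy hqv => by
      by_cases hqv' : q = v'
      · subst hqv'
        exact netLoad_eq_zero_of_untouched (hun.resolve_left hqy) g'
      · rw [← hnetq _ q (hzq q hq) hqv hqv' hqo]
        exact hg' q (Finset.mem_insert_of_mem hq) hqo hqy hqv'
    have hcE : netLoad x E g' (Sum.inr v) = c • netLoad x E s (Sum.inr v) := by
      rw [netLoad_congr hc, netLoad, netLoad, Finset.smul_sum]
      exact Finset.sum_congr rfl fun e _ => mul_smul _ _ _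
    have e1 := hg' v (Finset.mem_insert_of_mem h.v_mem) hρo hρy hv'v.symm
    rw [hnetv, hcE, hzv_eq] at e1
    -- At `v` the unknown tensions act along `g` and along the hanger, which are independent by
    -- `haim`; so both are determined by `c`. At `z` the remaining two are determined likewise.
    have e2 : (g' (Sum.inr z, Sum.inr v) * t + c) • g +
        (g' (Sum.inr v, Sum.inl u) - c * ρ.tension) • (x u - v) = 0 := by
      have hgr : netLoad x E s (Sum.inr v) = g - ρ.tension • (x u - v) := by rw [hg]; abel
      rw [← e1, hgr]
      module
    obtain ⟨e3, e4⟩ := eq_zero_of_smul_add_smul (haim _ (hxF u) hxv) e2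
    have e5 := hg' z (Finset.mem_insert_self _ _) hzo.symm hzy.symm hzv'.symm
    rw [hnetz, hvz_eq, smul_smul] at e5
    have e6 : (g' (Sum.inr z, Sum.inr v') - c * γ) • (v' - z) +
        (g' (Sum.inr z, Sum.inr o) - c * β) • (o - z) = 0 := by
      have : c • g = -(c * γ) • (v' - z) - (c * β) • (o - z) := by
        rw [← neg_neg g, hγβ]; module
      have e7 : g' (Sum.inr z, Sum.inr v) * -t = c := by linarith
      rw [e7, this] at e5
      rw [← e5]; module
    obtain ⟨e8, e9⟩ := eq_zero_of_smul_add_smul hW e6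
    refine ⟨c, fun e he => ?_⟩
    rcases (hmemE' e).1 he with rfl | rfl | rfl | rfl | he
    · rw [k1]; field_simp; linarith
    · rw [k2]; linarith
    · rw [k3]; linarith
    · rw [k4]; linarith
    · rw [k5 e he, hc e he]
  · intro σ hσ
    simp only [Finset.mem_insert]
    exact Or.inr (Or.inr (Or.inr (h.bar_mem σ (List.mem_cons_of_mem _ hσ))))
  · intro σ hσ hmem
    have hσS := h.node_mem σ (List.mem_cons_of_mem _ hσ)
    have hnd := hnodup σ hσ
    rcases (hmemE' _).1 hmem with he | he | he | he | he
    · simp [Hanger.bar] at he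
    · simp [Hanger.bar] at he
    · simp [Hanger.bar] at he
    · simp only [Hanger.bar, Prod.mk.injEq, Sum.inr.injEq] at he
      exact hnd he.1
    · exact h.bar_notMem σ (List.mem_cons_of_mem _ hσ) he
  · have := h.nodup
    rw [List.map_cons, List.nodup_cons] at this
    exact this.2
  · intro σ hσ hσv' e he
    have hσS := h.node_mem σ (List.mem_cons_of_mem _ hσ)
    have hσo := h.node_ne_o σ (List.mem_cons_of_mem _ hσ)
    have hnd := hnodup σ hσ
    have hσz := hzq _ hσS
    rcases (hmemE' _).1 he with rfl | rfl | rfl | rfl | he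
    · simp [hσz.symm, hnd.symm]
    · simp [hσz.symm, hσv'.symm]
    · simp [hσz.symm, hσo.symm]
    · simp [hnd.symm]
    · exact h.untouched σ (List.mem_cons_of_mem _ hσ) hnd e he
  · simp only [Finset.mem_insert]
    exact Or.inr (Or.inr (Or.inr h.closing_mem))
  · intro hmem
    rcases (hmemE' _).1 hmem with he | he | he | he | he
    · simp [hzo] at he
    · simp [hzo] at he
    · simp [hzo] at he
    · simp at he
    · exact h.closing_notMem he
  · rw [hnetv', k2, k6]; module
  -- The moment about `o` is unchanged when `g` slides along its line of action from `v` to `z`, and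
  -- the bar from `z` to `o` has no moment about `o`.
  · have h1 : wedge g (v - o) = wedge g (z - o) := by
      have : z - o = (v - o) + t • g := by rw [hz]; abel
      rw [this, wedge_add_right, wedge_smul_right, wedge_self, mul_zero, add_zero]
    rw [h1, ← neg_neg g, hγβ]
    simp [wedge]; ring

variable (x) in
/-- The torque about `o` of the force that is carried along the hangers, and that starts at `T`,
does not vanish. -/
def TorqueNe (o : Plane) : ℝ → List (Hanger p) → Prop
  | _, [] => True
  | T, ρ :: R => T + ρ.tension * wedge (x ρ.terminal - ρ.node) (ρ.node - o) ≠ 0 ∧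
      TorqueNe o (T + ρ.tension * wedge (x ρ.terminal - ρ.node) (ρ.node - o)) R

/-- Hangers only add constants, so each successive moment is affine in `t` with the same slope `b ≠
0`. -/
theorem eventually_torqueNe (o : Plane) (R : List (Hanger p)) (a : ℝ) {b : ℝ} (hb : b ≠ 0) :
    ∀ᶠ t in nhdsWithin (0 : ℝ) (Set.Ioi 0), TorqueNe x o (a + t * b) R := by
  induction R generalizing a with
  | nil => exact Filter.Eventually.of_forall fun _ => trivial
  | cons ρ R ih =>
    filter_upwards [eventually_affine_ne_zero
      (a := a + ρ.tension * wedge (x ρ.terminal - ρ.node) (ρ.node - o)) (Or.inr hb),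
      ih (a + ρ.tension * wedge (x ρ.terminal - ρ.node) (ρ.node - o))] with t h1 h2
    rw [TorqueNe, add_right_comm]
    exact ⟨h1, h2⟩

/-- Induction along the hangers, the last step leading to `y`. The node `z` of each step is chosen
such that the next force again aims at no node and no point of `F`. -/
theorem Carry.exists_closed {f : Fin p → Plane} {F : Finset Plane} {U : Set Plane} (hU : IsOpen U)
    {o y : Plane} (R : List (Hanger p)) {ρ : Hanger p} {S : Finset Plane} {G E : Finset (Bar p)}
    {s : Bar p → ℝ} (h : Carry x f F U o y ρ.node (ρ :: R) S G E s) {g : Plane}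
    (hg : g = netLoad x E s (Sum.inr ρ.node) + ρ.tension • (x ρ.terminal - ρ.node))
    (haim : ∀ d ∈ S ∪ F, d ≠ ρ.node → wedge g (d - ρ.node) ≠ 0)
    (hT : TorqueNe x o (wedge g (ρ.node - o)) R) :
    ∃ S' G' E' s', Carry x f F U o y y [] S' G' E' s' := by
  induction R generalizing ρ S G E s g with
  | nil =>
    obtain ⟨z, G', E', s', k, hC, -⟩ := h.step hU hg haim h.y_mem h.o_ne_y.symm
      (h.node_ne_y ρ List.mem_cons_self).symm (Or.inl rfl) Set.finite_empty
    exact ⟨_, G', E', s', hC⟩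
  | cons σ R ih =>
    have hσ : σ ∈ ρ :: σ :: R := List.mem_cons_of_mem _ List.mem_cons_self
    have hne : σ.node ≠ ρ.node := by
      intro hcon
      have := h.nodup
      rw [List.map_cons, List.nodup_cons] at this
      exact this.1 (List.mem_map.2 ⟨σ, List.mem_cons_self, hcon⟩)
    have hσo := h.node_ne_o σ hσ
    have hun := h.untouched σ hσ hne
    have hxF : x σ.terminal ∈ S ∪ F :=
      Finset.mem_union_right _ (h.generic.terminal_mem σ.terminal)
    have hxσ : x σ.terminal ≠ σ.node := fun hx =>
      h.generic.notMem _ (h.node_mem σ hσ) (hx ▸ h.generic.terminal_mem _)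
    set T := wedge g (ρ.node - o) with hTdef
    -- The next force is `k • (σ.node - z)` plus the pull of the hanger `σ`, where `k` depends on
    -- `z`. Multiplying its cross product with `d - σ.node` by `wedge (σ.node - z) (σ.node - o)` and
    -- replacing `k` by means of the moment `T` gives `wedge (σ.node - z) (V d)`: the force aims at
    -- `d` only if `z` is on the line through `σ.node` in the direction `V d`.
    let V : Plane → Plane := fun d => T • (d - σ.node) +
      (σ.tension * wedge (x σ.terminal - σ.node) (d - σ.node)) • (σ.node - o)
    have hT0 : T ≠ 0 := by
      have := haim o (Finset.mem_union_left _ h.o_mem) (h.node_ne_o ρ List.mem_cons_self).symm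
      rw [hTdef, ← neg_sub, wedge_neg_right]
      exact neg_ne_zero.2 this
    -- If `V d = 0`, then `T ≠ 0` makes `d - σ.node` a multiple of `σ.node - o`, and the nonzero
    -- moment after adding `σ` makes that multiple zero.
    have hV : ∀ d, d ≠ σ.node → V d ≠ 0 := by
      intro d hd h0
      have h1 : T * wedge (d - σ.node) (σ.node - o) = 0 := by
        have : wedge (V d) (σ.node - o) = 0 := by rw [h0, wedge_zero_left]
        simpa [V, wedge_add_left, wedge_smul_left] using this
      obtain ⟨c, hc⟩ := exists_eq_smul_of_wedge_eq_zero (sub_ne_zero.2 hσo)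
        ((mul_eq_zero.1 h1).resolve_left hT0)
      have h2 : V d = (c * (T + σ.tension * wedge (x σ.terminal - σ.node) (σ.node - o))) •
          (σ.node - o) := by
        simp only [V]
        rw [hc, wedge_smul_right]; module
      rw [h0] at h2
      have h3 := (smul_eq_zero.1 h2.symm).resolve_right (sub_ne_zero.2 hσo)
      have h4 : c = 0 := (mul_eq_zero.1 h3).resolve_right hT.1
      rw [h4, zero_smul] at hc
      exact hd (sub_eq_zero.1 hc)
    obtain ⟨z, G', E', s', k, hC, hnet, hk, hzd, hzV⟩ := h.step hU hg haim (h.node_mem σ hσ) hσo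
      hne (Or.inr hun) ((Finset.finite_toSet (S ∪ F)).image V)
    rw [netLoad_eq_zero_of_untouched hun, zero_add] at hnet
    refine ih hC rfl ?_ ?_
    · intro d hd hdσ
      rw [hnet, wedge_add_left, wedge_smul_left, wedge_smul_left]
      rw [Finset.insert_union] at hd
      rcases Finset.mem_insert.1 hd with rfl | hd
      -- For `d = z` the carried force acts along the line to `d`, so only the hanger contributes,
      -- and `z` is off the line of the hanger.
      · have h1 := hzd _ hxF hxσ
        rw [← neg_sub σ.node d, wedge_neg_right, wedge_self, neg_zero, mul_zero, zero_add,
          wedge_neg_right, ← wedge_neg_right, neg_sub, wedge_comm_neg]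
        exact mul_ne_zero (h.tension_ne σ hσ) (neg_ne_zero.2 h1)
      · intro h0
        apply hzV (V d) ⟨d, hd, rfl⟩ (hV d hdσ)
        have h1 : wedge (σ.node - z) (V d) = wedge (σ.node - z) (σ.node - o) *
            (k * wedge (σ.node - z) (d - σ.node) +
              σ.tension * wedge (x σ.terminal - σ.node) (d - σ.node)) := by
          simp only [V, wedge_add_right, wedge_smul_right]
          rw [hTdef, ← hk]; ring
        rw [← neg_sub σ.node z, wedge_neg_left, h1, h0, mul_zero, neg_zero]
    · have : wedge (netLoad x E' s' (Sum.inr σ.node) + σ.tension • (x σ.terminal - σ.node))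
          (σ.node - o) = T + σ.tension * wedge (x σ.terminal - σ.node) (σ.node - o) := by
        rw [hnet, wedge_add_left, wedge_smul_left, wedge_smul_left, hk]
      rw [this]
      exact hT.2

/-! ### Closing the chain. -/

/-- The forces exerted by bars do no work in a displacement that does not elongate the bars. -/
theorem netLoad_work_eq_zero {S : Finset Plane} {E : Finset (Bar p)}
    (hl : ∀ e ∈ E, IsNode S e.1) (hr : ∀ e ∈ E, IsNode S e.2) (s : Bar p → ℝ)
    {V : FrameNode p → Plane} (hV : ∀ e ∈ E, elongation x V e = 0) :
    ∑ i, inner ℝ (netLoad x E s (Sum.inl i)) (V (Sum.inl i)) +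
      ∑ z ∈ S, inner ℝ (netLoad x E s (Sum.inr z)) (V (Sum.inr z)) = 0 := by
  let j : Fin p ⊕ S → FrameNode p := Sum.map id Subtype.val
  have hj : Function.Injective j := Function.Injective.sumMap Function.injective_id
    Subtype.val_injective
  have hjS : ∀ a : FrameNode p, IsNode S a → ∃ b, j b = a := by
    rintro (i | z) ha
    · exact ⟨Sum.inl i, rfl⟩
    · exact ⟨Sum.inr ⟨z, ha z rfl⟩, rfl⟩
  have h1 := netLoad_virtual_work (x := x) hj
    (fun e he => ⟨hjS _ (hl e he), hjS _ (hr e he)⟩) s V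
  have h2 : ∑ e ∈ E, s e * elongation x V e = 0 :=
    Finset.sum_eq_zero fun e he => by rw [hV e he, mul_zero]
  rw [Fintype.sum_sum_type, h2] at h1
  rw [← h1, ← Finset.sum_coe_sort S]
  rfl

/-- Rigid motions do not elongate bars. The rotation about `o` shows that the force left at `y` acts
along the line `oy`, so the closing bar can cancel it; the translations then give equilibrium at
`o`. Equilibrium at `y` ties the tension of the closing bar to the common factor. -/
theorem Carry.exists_isRankOne {f : Fin p → Plane} (hf : IsBalanced x f) {F : Finset Plane}
    {U : Set Plane} {o y : Plane} {S : Finset Plane} {G E : Finset (Bar p)} {s : Bar p → ℝ}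
    (h : Carry x f F U o y y [] S G E s) :
    ∃ s', IsRankOne x f S (insert (Sum.inr o, Sum.inr y) E) s' := by
  have hl : ∀ e ∈ E, IsNode S e.1 := fun e he => h.generic.left e (h.sub he)
  have hr : ∀ e ∈ E, IsNode S e.2 := fun e he => h.generic.right e (h.sub he)
  have hterm : ∀ i, netLoad x E s (Sum.inl i) = f i := fun i => by
    have := h.terminal i
    simpa [hangerForce] using this
  have hyo : y ≠ o := h.o_ne_y.symm
  -- Rotation by a right angle: `J (q - o)` is the velocity at `q` of a rotation about `o`, and its
  -- work is the moment about `o`.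
  let J : Plane → Plane := fun v => WithLp.toLp 2 ![-v 1, v 0]
  have hJ : ∀ v w : Plane, inner ℝ v (J w) = wedge w v := by
    intro v w
    simp [J, wedge, PiLp.inner_apply, Fin.sum_univ_two]
    ring
  have htorque : wedge (netLoad x E s (Sum.inr y)) (y - o) = 0 := by
    have h1 := netLoad_work_eq_zero hl hr s (V := fun a => J (nodePos x a - o)) (fun e _ => by
      rw [elongation, inner_sub_right, hJ, hJ, ← wedge_sub_left]
      have : nodePos x e.1 - o - (nodePos x e.2 - o) = -barDir x e := by rw [barDir]; abel
      rw [this, wedge_neg_left, wedge_self, neg_zero])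
    simp only [hJ, hterm, nodePos_inl, nodePos_inr, wedge_sub_left] at h1
    rw [Finset.sum_sub_distrib, hf.torque, ← wedge_sum_right, hf.force, wedge_zero_right,
      Finset.sum_eq_single y] at h1
    · rw [wedge_comm_neg, wedge_sub_left]; linarith
    · intro q hq hqy
      by_cases hqo : q = o
      · rw [hqo, sub_self]
      · rw [h.internal q hq hqo hqy hqy, wedge_zero_right, wedge_zero_right, sub_zero]
    · exact fun hy => absurd h.y_mem hy
  obtain ⟨c, hc⟩ := exists_eq_smul_of_wedge_eq_zero (sub_ne_zero.2 hyo) htorque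
  let s' : Bar p → ℝ := Function.update s (Sum.inr o, Sum.inr y) c
  have hs'E : ∀ e ∈ E, s' e = s e := fun e he =>
    Function.update_of_ne (fun hcon : e = (Sum.inr o, Sum.inr y) => h.closing_notMem (hcon ▸ he)) _ _
  have hs'c : s' (Sum.inr o, Sum.inr y) = c := Function.update_self _ _ _
  have hnet : ∀ (g : Bar p → ℝ) a, netLoad x (insert (Sum.inr o, Sum.inr y) E) g a =
      g (Sum.inr o, Sum.inr y) • barLoad x (Sum.inr o, Sum.inr y) a + netLoad x E g a :=
    fun g a => netLoad_insert h.closing_notMem g a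
  have hnety : ∀ g : Bar p → ℝ, netLoad x (insert (Sum.inr o, Sum.inr y) E) g (Sum.inr y) =
      g (Sum.inr o, Sum.inr y) • (o - y) + netLoad x E g (Sum.inr y) := by
    intro g
    rw [hnet]
    simp [barLoad, barDir, hyo]
  have hnetq : ∀ (g : Bar p → ℝ) q, q ≠ o → q ≠ y →
      netLoad x (insert (Sum.inr o, Sum.inr y) E) g (Sum.inr q) = netLoad x E g (Sum.inr q) := by
    intro g q h1 h2
    rw [hnet]
    simp [barLoad, h1, h2]
  have hneti : ∀ (g : Bar p → ℝ) i,
      netLoad x (insert (Sum.inr o, Sum.inr y) E) g (Sum.inl i) = netLoad x E g (Sum.inl i) := by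
    intro g i
    rw [hnet]
    simp [barLoad]
  have hqeq : ∀ q ∈ S, q ≠ o →
      netLoad x (insert (Sum.inr o, Sum.inr y) E) s' (Sum.inr q) = 0 := by
    intro q hq hqo
    by_cases hqy : q = y
    · rw [hqy, hnety, hs'c, netLoad_congr hs'E, hc]; module
    · rw [hnetq _ q hqo hqy, netLoad_congr hs'E]
      exact h.internal q hq hqo hqy hqy
  have hterm' : ∀ i, netLoad x (insert (Sum.inr o, Sum.inr y) E) s' (Sum.inl i) = f i := by
    intro i
    rw [hneti, netLoad_congr hs'E, hterm]
  refine ⟨s', ?_, hterm', ?_⟩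
  · intro q hq
    by_cases hqo : q = o
    -- The test displacement is a translation by the load at `o`. Only `o` contributes, because the
    -- forces `f` sum to zero and all other internal nodes are in equilibrium.
    · have h1 := netLoad_work_eq_zero (x := x) (S := S) (E := insert (Sum.inr o, Sum.inr y) E)
        (fun e he => by
          rcases Finset.mem_insert.1 he with rfl | he
          · exact isNode_inr h.o_mem
          · exact hl e he)
        (fun e he => by
          rcases Finset.mem_insert.1 he with rfl | he
          · exact isNode_inr h.y_mem
          · exact hr e he) s'
        (V := fun _ => netLoad x (insert (Sum.inr o, Sum.inr y) E) s' (Sum.inr q))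
        (fun e _ => by simp [elongation])
      simp only [hterm'] at h1
      rw [← sum_inner, hf.force, inner_zero_left, zero_add, Finset.sum_eq_single q] at h1
      · exact inner_self_eq_zero.1 h1
      · intro r hr hrq
        rw [hqeq r hr (fun hro => hrq (hro.trans hqo.symm)), inner_zero_left]
      · exact fun hq' => absurd hq hq'
    · exact hqeq q hq hqo
  · intro g hg
    obtain ⟨b, hb⟩ := h.unique g fun q hq hqo hqy _ => by
      rw [← hnetq g q hqo hqy]; exact hg q hq
    refine ⟨b, fun e he => ?_⟩
    rcases Finset.mem_insert.1 he with rfl | he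
    · have h1 := hg y h.y_mem
      have h2 : netLoad x E g (Sum.inr y) = b • netLoad x E s (Sum.inr y) := by
        rw [netLoad_congr hb, netLoad, netLoad, Finset.smul_sum]
        exact Finset.sum_congr rfl fun e _ => mul_smul _ _ _
      rw [hnety, h2, hc] at h1
      have h3 : (b * c - g (Sum.inr o, Sum.inr y)) • (y - o) = 0 := by
        rw [← h1]; module
      rw [hs'c]
      linarith [(smul_eq_zero.1 h3).resolve_right (sub_ne_zero.2 hyo)]
    · rw [hs'E e he, hb e he]

/-! ### Hangers at the terminals and assembly of the frame. -/

theorem hangerForce_eq_zero {R : List (Hanger p)} {i : Fin p}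
    (h : ∀ ρ ∈ R, i ≠ ρ.terminal) : hangerForce x R i = 0 := by
  induction R with
  | nil => rfl
  | cons ρ R ih =>
    rw [hangerForce_cons, if_neg (h ρ List.mem_cons_self), zero_add]
    exact ih fun σ hσ => h σ (List.mem_cons_of_mem _ hσ)

/-- The forces at the terminals are balanced by hangers in general position. -/
theorem exists_hangers (f : Fin p → Plane) {F : Finset Plane} {U : Set Plane} (hU : IsOpen U)
    (hxU : ∀ i, x i ∈ U) (hxF : ∀ i, x i ∈ F) (T : Finset (Fin p)) (hT : ∀ i ∈ T, f i ≠ 0) :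
    ∃ (R : List (Hanger p)) (S : Finset Plane) (G : Finset (Bar p)), Generic x F S G ∧
      (∀ q ∈ S, q ∈ U) ∧ (∀ ρ ∈ R, ρ.node ∈ S ∧ ρ.tension ≠ 0 ∧ ρ.bar ∈ G ∧ ρ.terminal ∈ T) ∧
      (R.map Hanger.node).Nodup ∧ ∀ i ∈ T, hangerForce x R i = f i := by
  induction T using Finset.induction_on with
  | empty =>
    refine ⟨[], ∅, ∅, ⟨hxF, ?_, ?_, ?_, ?_, ?_, ?_, ?_⟩, ?_, ?_, List.nodup_nil, ?_⟩ <;> simp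
  | insert i T hi ih =>
    obtain ⟨R, S, G, hG, hSU, hR, hnd, hforce⟩ :=
      ih fun j hj => hT j (Finset.mem_insert_of_mem hj)
    have hfi := hT i (Finset.mem_insert_self _ _)
    -- The nodes `w` and `w'` are kept off the line through `x i` in the direction `f i`, so that
    -- neither hanger has zero tension.
    obtain ⟨w, hwU, hwS, -, hwf, hwG⟩ := hG.exists_node hU (hxU i) (x i, f i)
    have hG1 := hwG (Sum.inl i) (isNode_inl S i)
    obtain ⟨w', hwU', hwS', hww', hwf', hwG'⟩ := hG1.exists_node hU (hxU i) (x i, f i)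
    have hG2 := hwG' (Sum.inl i) (isNode_inl _ i)
    have hwf1 := hwf hfi
    have hwf1' := hwf' hfi
    have hwx : wedge (w - x i) (w' - x i) ≠ 0 := by
      rw [wedge_comm_neg]
      refine neg_ne_zero.2 (hww' (x i) (Finset.mem_union_right _ (hxF i)) w
        (Finset.mem_union_left _ (Finset.mem_insert_self _ _)) ?_)
      intro hxw
      exact hwS (Finset.mem_union_right _ (hxw ▸ hxF i))
    have hne : w' ≠ w := fun hcon => hwS' (Finset.mem_union_left _
      (hcon ▸ Finset.mem_insert_self _ _))
    -- Cramer's rule for `f i` in the basis `w - x i`, `w' - x i`.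
    refine ⟨⟨i, w, wedge (f i) (w' - x i) / wedge (w - x i) (w' - x i)⟩ ::
      ⟨i, w', wedge (w - x i) (f i) / wedge (w - x i) (w' - x i)⟩ :: R, _, _, hG2, ?_, ?_, ?_, ?_⟩
    · intro q hq
      rcases Finset.mem_insert.1 hq with rfl | hq
      · exact hwU'
      rcases Finset.mem_insert.1 hq with rfl | hq
      · exact hwU
      · exact hSU q hq
    · intro ρ hρ
      rcases List.mem_cons.1 hρ with rfl | hρ
      · refine ⟨by simp, div_ne_zero ?_ hwx, by simp [Hanger.bar], by simp⟩
        rw [wedge_comm_neg]; exact neg_ne_zero.2 hwf1'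
      rcases List.mem_cons.1 hρ with rfl | hρ
      · exact ⟨by simp, div_ne_zero hwf1 hwx, by simp [Hanger.bar], by simp⟩
      · obtain ⟨h1, h2, h3, h4⟩ := hR ρ hρ
        exact ⟨by simp [h1], h2, by simp [h3], by simp [h4]⟩
    · have hnotMem : ∀ q, q ∉ S → q ∉ R.map Hanger.node := by
        intro q hq hqR
        obtain ⟨ρ, hρ, rfl⟩ := List.mem_map.1 hqR
        exact hq (hR ρ hρ).1
      have h1 : w ∉ S := fun hw => hwS (Finset.mem_union_left _ hw)
      have h2 : w' ∉ S := fun hw => hwS' (Finset.mem_union_left _ (Finset.mem_insert_of_mem hw))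
      rw [List.map_cons, List.map_cons, List.nodup_cons, List.nodup_cons, List.mem_cons]
      exact ⟨not_or.2 ⟨hne.symm, hnotMem w h1⟩, hnotMem w' h2, hnd⟩
    · intro k hk
      rw [hangerForce_cons, hangerForce_cons]
      rcases Finset.mem_insert.1 hk with rfl | hk
      · rw [hangerForce_eq_zero fun ρ hρ (hcon : k = _) => hi (hcon ▸ (hR ρ hρ).2.2.2), add_zero,
          if_pos rfl, if_pos rfl]
        exact (exists_eq_smul_add_smul hwx (f k)).symm
      · have hki : k ≠ i := fun hcon => hi (hcon ▸ hk)
        rw [if_neg hki, if_neg hki, zero_add, zero_add, hforce k hk]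

theorem exists_rankOne_frame {f : Fin p → Plane} (hf : IsBalanced x f) (hf0 : f ≠ 0)
    {F : Finset Plane} {U : Set Plane} (hU : IsOpen U) (hxU : ∀ i, x i ∈ U)
    (hxF : ∀ i, x i ∈ F) :
    ∃ S G s, Generic x F S G ∧ IsRankOne x f S G s ∧ ∀ q ∈ S, q ∈ U := by
  obtain ⟨R, S, G, hG, hSU, hR, hnd, hforce⟩ := exists_hangers f hU hxU hxF
    (Finset.univ.filter fun i => f i ≠ 0) (by simp)
  have hforce' : ∀ i, hangerForce x R i = f i := by
    intro i
    by_cases hi : f i = 0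
    · rw [hi]
      refine hangerForce_eq_zero fun ρ hρ hcon => ?_
      have := (hR ρ hρ).2.2.2
      rw [Finset.mem_filter, ← hcon] at this
      exact this.2 hi
    · exact hforce i (by simp [hi])
  obtain - | ⟨ρ, R⟩ := R
  · exact absurd (funext fun i => (hforce' i).symm) hf0
  set w := ρ.node with hw
  obtain ⟨hwS, hα, hbar, -⟩ := hR ρ List.mem_cons_self
  have hwF : w ∉ F := hG.notMem w hwS
  have hxw : ∀ i, x i ≠ w := fun i hx => hwF (hx ▸ hxF i)
  -- The pair `(0, 0)` has direction zero and so imposes no further line to avoid.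
  obtain ⟨y, hyU, hyS, hyy, -, hyG⟩ := hG.exists_node hU (hxU ρ.terminal) (0, 0)
  have hG1 := hyG (Sum.inr w) (isNode_inr hwS)
  obtain ⟨o, hoU, hoS, hoo, -, hoG⟩ := hG1.exists_node hU (hxU ρ.terminal) (0, 0)
  have hG2 := hoG (Sum.inr y) (isNode_inr (Finset.mem_insert_self _ _))
  have hyS' : ∀ q ∈ S, q ≠ y := fun q hq hqy => hyS (Finset.mem_union_left _ (hqy ▸ hq))
  have hoS' : ∀ q ∈ insert y S, q ≠ o := fun q hq hqo =>
    hoS (Finset.mem_union_left _ (hqo ▸ hq))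
  have hoy : o ≠ y := (hoS' y (Finset.mem_insert_self _ _)).symm
  have hwy : w ≠ y := hyS' w hwS
  have hwSF : w ∈ S ∪ F := Finset.mem_union_left _ hwS
  have hyd : ∀ d ∈ S ∪ F, d ≠ w → wedge (y - w) (d - w) ≠ 0 := fun d hd hdw =>
    hyy w hwSF d hd hdw.symm
  have hyo : wedge (y - w) (o - w) ≠ 0 := by
    rw [wedge_comm_neg]
    exact neg_ne_zero.2 (hoo w (Finset.mem_union_left _ (Finset.mem_insert_of_mem hwS)) y
      (Finset.mem_union_left _ (Finset.mem_insert_self _ _)) hwy)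
  -- The first force, the pull of the hanger at `w` plus `κ • (y - w)`, must aim at no `d`. For `d =
  -- y` the hanger term is nonzero, for every other `d` the term in `κ` is.
  have hev1 : ∀ᶠ κ in nhdsWithin (0 : ℝ) (Set.Ioi 0), ∀ d ∈ insert o (insert y S) ∪ F, d ≠ w →
      ρ.tension * wedge (x ρ.terminal - w) (d - w) + κ * wedge (y - w) (d - w) ≠ 0 := by
    refine (Filter.eventually_all_finset _).2 fun d hd => ?_
    by_cases hdw : d = w
    · exact Filter.Eventually.of_forall fun _ h => absurd hdw h
    have hne : ρ.tension * wedge (x ρ.terminal - w) (d - w) ≠ 0 ∨ wedge (y - w) (d - w) ≠ 0 := by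
      rw [Finset.insert_union, Finset.insert_union] at hd
      rcases Finset.mem_insert.1 hd with rfl | hd
      · exact Or.inr hyo
      rcases Finset.mem_insert.1 hd with rfl | hd
      · left
        rw [wedge_comm_neg]
        exact mul_ne_zero hα (neg_ne_zero.2 (hyd _ (Finset.mem_union_right _ (hxF _)) (hxw _)))
      · exact Or.inr (hyd d hd hdw)
    filter_upwards [eventually_affine_ne_zero hne] with κ h _ using h
  -- The moments about `o` have slope `wedge (y - w) (w - o)` in `κ`, nonzero because `y`, `w`, `o`
  -- are not collinear.
  have hev2 := eventually_torqueNe (x := x) o R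
    (ρ.tension * wedge (x ρ.terminal - w) (w - o)) (b := wedge (y - w) (w - o)) (by
      rw [← neg_sub o w, wedge_neg_right]; exact neg_ne_zero.2 hyo)
  obtain ⟨κ, ⟨hκ1, hκ2⟩, hκ0⟩ := ((hev1.and hev2).and self_mem_nhdsWithin).exists
  have hκ : κ ≠ 0 := (Set.mem_Ioi.1 hκ0).ne'
  have hnet : ∀ (g : Bar p → ℝ) (a : FrameNode p), netLoad x {(Sum.inr y, Sum.inr w)} g a =
      g (Sum.inr y, Sum.inr w) • barLoad x (Sum.inr y, Sum.inr w) a :=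
    fun g a => Finset.sum_singleton _ _
  have hnode : ∀ σ ∈ ρ :: R, σ.node ∈ S := fun σ hσ => (hR σ hσ).1
  have hC : Carry x f F U o y w (ρ :: R) (insert o (insert y S))
      (insert (Sum.inr o, Sum.inr y) (insert (Sum.inr y, Sum.inr w) G))
      {(Sum.inr y, Sum.inr w)} (fun _ => κ) := by
    refine ⟨hG2, ?_, by simp, by simp, by simp,
      Finset.mem_insert_of_mem (Finset.mem_insert_of_mem hwS), hoy, ?_, ?_, ?_,
      fun σ hσ => by simp [hnode σ hσ], fun σ hσ => hoS' _ (Finset.mem_insert_of_mem (hnode σ hσ)),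
      fun σ hσ => hyS' _ (hnode σ hσ), fun σ hσ => (hR σ hσ).2.1,
      fun σ hσ => by simp [(hR σ hσ).2.2.1], fun σ _ => by simp [Hanger.bar], hnd, ?_, by simp,
      by simp [hoy]⟩
    · intro q hq
      rcases Finset.mem_insert.1 hq with rfl | hq
      · exact hoU
      rcases Finset.mem_insert.1 hq with rfl | hq
      · exact hyU
      · exact hSU q hq
    · intro q _ _ hqy hqw
      rw [hnet, barLoad_of_ne (by simpa using hqy) (by simpa using hqw), smul_zero]
    · intro i
      rw [hnet, barLoad_of_ne (by simp) (by simp), smul_zero, zero_add, hforce']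
    · intro g _
      refine ⟨g (Sum.inr y, Sum.inr w) / κ, fun e he => ?_⟩
      rw [Finset.mem_singleton.1 he, div_mul_cancel₀ _ hκ]
    · intro σ hσ hσw e he
      rw [Finset.mem_singleton.1 he]
      simp only [ne_eq, Sum.inr.injEq]
      exact ⟨(hyS' _ (hnode σ hσ)).symm, hσw.symm⟩
  have hnetw : netLoad x {((Sum.inr y, Sum.inr w) : Bar p)} (fun _ => κ) (Sum.inr w) =
      κ • (y - w) := by
    rw [hnet]; simp [barLoad, barDir, hwy]
  obtain ⟨S', G', E', s', hC'⟩ := hC.exists_closed hU R rfl (fun d hd hdw => by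
      have := hκ1 d hd hdw
      rwa [← hw, hnetw, wedge_add_left, wedge_smul_left, wedge_smul_left, add_comm]) (by
      rw [← hw, hnetw, wedge_add_left, wedge_smul_left, wedge_smul_left, add_comm]
      exact hκ2)
  obtain ⟨s'', hs''⟩ := hC'.exists_isRankOne hf
  refine ⟨S', _, s'', hC'.generic.subset ?_, hs'', hC'.mem⟩
  intro e he
  rcases Finset.mem_insert.1 he with rfl | he
  · exact hC'.closing_mem
  · exact hC'.sub he

theorem frameNetwork_empty_isResponseMatrix :
    (frameNetwork x ∅ ∅).IsResponseMatrix 0 := by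
  refine ⟨Matrix.isSymm_zero, fun u => ?_⟩
  have : ∀ v, (frameNetwork x ∅ ∅).quadForm (Sum.elim u v) = 0 := by
    intro v
    simp [ElasticNetwork.quadForm, frameNetwork_stiffness]
  simp [ElasticNetwork.responseForm, this]

end Frames

/-! ### The main theorem. -/

theorem mainTheorem4 (p : ℕ) (x f : Fin p → Plane) (hf : IsBalanced x f)
    (ε : ℝ) (hε : 0 < ε) (F : Finset Plane) :
    ∃ N : ElasticNetwork x, N.IsPlanar ∧
      (∃ c : ℝ, 0 < c ∧ N.IsResponseMatrix (c • Matrix.vecMulVec (stack f) (stack f))) ∧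
      ∀ j, N.internal j ∈ Metric.cthickening ε (convexHull ℝ (Set.range x)) ∧ N.internal j ∉ F := by
  classical
  -- For `f = 0` the network without internal nodes and springs serves, with any `c`. Otherwise the
  -- stress is nonzero, as needed for `c = 1 / ∑ s²`.
  by_cases hf0 : f = 0
  · have hG : Generic x (Finset.univ.image x) ∅ ∅ := by
      refine ⟨by simp, ?_, ?_, ?_, ?_, ?_, ?_, ?_⟩ <;> simp
    refine ⟨frameNetwork x ∅ ∅, frameNetwork_isPlanar hG (by simp), ⟨1, one_pos, ?_⟩,
      fun j => j.elim0⟩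
    have h0 : (1 : ℝ) • Matrix.vecMulVec (stack f) (stack f) = 0 := by
      ext a b
      simp [Matrix.vecMulVec_apply, stack, hf0]
    rw [h0]
    exact frameNetwork_empty_isResponseMatrix
  · have hxU : ∀ i, x i ∈ Metric.thickening ε (convexHull ℝ (Set.range x)) := fun i =>
      Metric.self_subset_thickening hε _ (subset_convexHull ℝ _ (Set.mem_range_self i))
    -- The terminals join the forbidden points. The open thickening leaves room to perturb nodes,
    -- and its convexity keeps the crossings inside.
    obtain ⟨S, G, s, hG, hs, hS⟩ := exists_rankOne_frame hf hf0 (F := F ∪ Finset.univ.image x)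
      Metric.isOpen_thickening hxU (by simp)
    obtain ⟨S, G, s, hG, hs, hS, hd⟩ := exists_planar ((convex_convexHull ℝ _).thickening ε) hxU
      hG hs hS
    refine ⟨frameNetwork x S G, frameNetwork_isPlanar hG hd, ⟨_, inv_pos.2 (hs.sum_sq_pos hf0),
      frameNetwork_isResponseMatrix hG hs hf0⟩, fun j => ?_⟩
    have hj : (frameNetwork x S G).internal j ∈ S := (S.equivFin.symm j).2
    exact ⟨Metric.thickening_subset_cthickening ε _ (hS _ hj),
      fun hF => hG.notMem _ hj (Finset.mem_union_left _ hF)⟩
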